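/- **Setting.** Let $H_{\rm targ}=H_{\rm else}+\sum_{j=1}^M\gamma_j\,A_{a_j}\otimes B_{b_j}$ be a Hamiltonian on $n$ qubits, where $a_j\ne b_j$ are qubits, $A_{a_j},B_{b_j}\in\{\mathbb I,X,Y,Z\}$ are Pauli operators on these qubits, $\gamma_j\in\mathbb R$, $H_{\rm else}\ge 0$, and $\gamma_{\max}=\max_j|\gamma_j|>0$. For integers $R,C$ and a real number $J$, the parallel weak 2-body gadget adds $MR$ direct ancilla qubits $w_i^{(j)}$ ($1\le j\le M$, $1\le i\le R$) and $C$ core ancilla qubits forming a set $\mathcal C$. It is the Hamiltonian $\tilde H=H+V$ with $$H=\frac J2\sum_{j=1}^M\sum_{i=1}^R\sum_{c\in\mathcal C}\bigl(\mathbb I-Z_{w_i^{(j)}}Z_c\bigr)+\frac J2\sum_{c\in\mathcal C}(\mathbb I-Z_c)+\frac J2\sum_{\{c,c'\}\subset\mathcal C,\ c\neq c'}(\mathbb I-Z_cZ_{c'}),$$ $$V=H_{\rm else}+\sum_{j=1}^M\beta_j\sum_{i=1}^R\bigl(A_{a_j}-\operatorname{sgn}(\gamma_j)B_{b_j}\bigr)\otimes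 X_{w_i^{(j)}},\qquad \beta_j=\sqrt{\frac{|\gamma_j|\,JC}{2R}} .$$ The ground space $\mathcal L_-$ of $H$ consists of the states with all ancillas in $|0\rangle$. It has energy $0$, and the spectral gap above it is $\Delta=JC$. Let $\Pi_-$ be the orthogonal projector onto $\mathcal L_-$ and $\Pi_+=\mathbb I-\Pi_-$. Write $O_\pm=\Pi_\pm O\Pi_\pm$, $O_{-+}=\Pi_-O\Pi_+$, $O_{+-}=\Pi_+O\Pi_-$. Let $G_+(z)$ be the inverse of $z-H$ on the range of $\Pi_+$, extended by $0$. Let $$T_m(z)=V_{-+}\bigl(G_+(z)V_+\bigr)^{m-2}G_+(z)V_{+-}\quad(m\ge2),\qquad \Sigma_-(z)=H_-+V_-+\sum_{m\ge2}T_m(z).$$ Below, $\Pi_-$ also denotes the projector onto the all-zero state of the ancilla register when it appears as a tensor factor, and $\|\cdot\|$ is the operator norm. **Statement.** Fix $d\in(0,1)$, $\Gamma>0$ and $\epsilon_0>0$. There are constants $K,c>0$, depending only on $d,\Gamma,\epsilon_0$, such that the following holds for all $n,M,R,C$, all data as above with $\gamma_{\max}\le\Gamma$, and all $0<\epsilon\le\epsilon_0$.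 Suppose $\Delta=JC=M^3R^d$ and $$R\ \ge\ K\max\Bigl\{\epsilon^{-2/d},\ \Bigl(\frac{\|H_{\rm else}\|^2}{2M^4\gamma_{\max}}\Bigr)^{1/d},\ \bigl(M^3\epsilon^{-2}\bigr)^{1/(1-d)}\Bigr\},\qquad C\ \ge\ K\,M^3R^d\epsilon^{-1}.$$ Then all couplings are weak: $|\beta_j|\le c\,\epsilon$ for every $j$, and $|J|\le c\,\epsilon$. Moreover, for every $z\in\mathbb C$ with $|z|\le\epsilon+\|H_{\rm else}\|+\sum_{j}|\gamma_j|$: 1. $z-H$ is invertible on the range of $\Pi_+$, and $\sum_{m\ge2}\|T_m(z)\|<\infty$, so the self-energy series converges. 2. Up to the overall energy shift $-\sum_j|\gamma_j|$, the self-energy is the target Hamiltonian: $$\Bigl\|\Sigma_-(z)-\Bigl(H_{\rm targ}-\sum_j|\gamma_j|\,\mathbb I\Bigr)\otimes\Pi_-\Bigr\|\le c\,\epsilon .$$ 3. For every $m\ge3$, $\ \|T_m(z)\|\le3\sqrt2\,\Delta\,q^m$ with $q=\sqrt{18M\gamma_{\max}/\Delta}$. 4. If $z$ is not an eigenvalue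 of $\tilde H$, then $\Pi_-(z-\tilde H)^{-1}\Pi_-$ is invertible on $\mathcal L_-$, and $\Sigma_-(z)=z-\bigl(\Pi_-(z-\tilde H)^{-1}\Pi_-\bigr)^{-1}$ on $\mathcal L_-$. -/

import Mathlib

open scoped Kronecker Matrix.Norms.L2Operator ComplexOrder

noncomputable section

namespace WeakGadget

/-! ### Qubit operators -/

/-- Labels of the four single-qubit Pauli operators. -/
inductive Pauli
  | I
  | X
  | Y
  | Z

/-- The Pauli matrices, in the computational basis `0, 1`. -/
def Pauli.mat : Pauli → Matrix (Fin 2) (Fin 2) ℂ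
  | Pauli.I => 1
  | Pauli.X => !![0, 1; 1, 0]
  | Pauli.Y => !![0, -Complex.I; Complex.I, 0]
  | Pauli.Z => !![1, 0; 0, -1]

/-- Operators on a register of qubits labelled by `ι`; bit strings `ι → Fin 2` label the
computational basis. -/
abbrev Op (ι : Type) := Matrix (ι → Fin 2) (ι → Fin 2) ℂ

/-- The Pauli operator `P` acting on qubit `k` (and trivially on all the others). -/
def site {ι : Type} [Fintype ι] [DecidableEq ι] (P : Pauli) (k : ι) : Op ι :=
  Matrix.of fun x y => if ∀ i, i ≠ k → x i = y i then P.mat (x k) (y k) else 0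

/-! ### The target Hamiltonian -/

/-- The data of a target Hamiltonian `H_else + ∑ j, γ j • A_{a j} ⊗ B_{b j}` on `n` qubits. -/
structure Target (n M : ℕ) where
  a : Fin M → Fin n
  b : Fin M → Fin n
  A : Fin M → Pauli
  B : Fin M → Pauli
  γ : Fin M → ℝ
  Helse : Op (Fin n)

namespace Target

variable {n M : ℕ} (T : Target n M)

/-- The Pauli operator `A_{a j}` on the target register. -/
def opA (j : Fin M) : Op (Fin n) := site (T.A j) (T.a j)

/-- The Pauli operator `B_{b j}` on the target register. -/
def opB (j : Fin M) : Op (Fin n) := site (T.B j) (T.b j)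

/-- The target Hamiltonian. -/
def Htarg : Op (Fin n) := T.Helse + ∑ j, (T.γ j : ℂ) • (T.opA j * T.opB j)

/-- The largest coupling `max_j |γ j|`. -/
def gammaMax : ℝ := ⨆ j, |T.γ j|

end Target

/-! ### The parallel gadget -/

/-- Labels of the ancilla qubits: `R` direct ancillas for each of the `M` terms, and `C` core
ancillas. -/
abbrev Anc (M R C : ℕ) := (Fin M × Fin R) ⊕ Fin C

/-- Computational basis of the whole system: target register and ancilla register. -/
abbrev Basis (n M R C : ℕ) := (Fin n → Fin 2) × (Anc M R C → Fin 2)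

/-- Operators on the whole system. -/
abbrev SysOp (n M R C : ℕ) := Matrix (Basis n M R C) (Basis n M R C) ℂ

/-- The core Hamiltonian: a local field on each core qubit, and a ferromagnetic interaction for
each (unordered) pair of core qubits. -/
def coreH (M R C : ℕ) (J : ℝ) : Op (Anc M R C) :=
  ((J / 2 : ℝ) : ℂ) • ∑ c : Fin C, (1 - site Pauli.Z (Sum.inr c)) +
  ((J / 2 : ℝ) : ℂ) • ∑ c : Fin C, ∑ c' ∈ Finset.Ioi c,
    (1 - site Pauli.Z (Sum.inr c) * site Pauli.Z (Sum.inr c'))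

/-- The unperturbed Hamiltonian on the ancilla register. -/
def ancH (M R C : ℕ) (J : ℝ) : Op (Anc M R C) :=
  ((J / 2 : ℝ) : ℂ) • ∑ j : Fin M, ∑ i : Fin R, ∑ c : Fin C,
    (1 - site Pauli.Z (Sum.inl (j, i)) * site Pauli.Z (Sum.inr c)) +
  coreH M R C J

/-- The unperturbed Hamiltonian `H` on the whole system. -/
def H (n M R C : ℕ) (J : ℝ) : SysOp n M R C := 1 ⊗ₖ ancH M R C J

/-- The eigenvalue `1` or `-1` of the Pauli `Z` on a bit. -/
def zval (b : Fin 2) : ℝ := if b = 0 then 1 else -1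

/-- The energy of an ancilla bit string. -/
def energy (M R C : ℕ) (J : ℝ) (y : Anc M R C → Fin 2) : ℝ :=
  J / 2 * ∑ j : Fin M, ∑ i : Fin R, ∑ c : Fin C,
    (1 - zval (y (Sum.inl (j, i))) * zval (y (Sum.inr c))) +
  (J / 2 * ∑ c : Fin C, (1 - zval (y (Sum.inr c))) +
  J / 2 * ∑ c : Fin C, ∑ c' ∈ Finset.Ioi c,
    (1 - zval (y (Sum.inr c)) * zval (y (Sum.inr c'))))

theorem site_Z {ι : Type} [Fintype ι] [DecidableEq ι] (k : ι) :
    site Pauli.Z k = Matrix.diagonal fun x : ι → Fin 2 => ((zval (x k) : ℝ) : ℂ) := by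
  ext x y
  by_cases hxy : x = y
  · subst hxy
    have : ∀ b : Fin 2, Pauli.Z.mat b b = ((zval b : ℝ) : ℂ) := by
      intro b; fin_cases b <;> simp [Pauli.mat, zval]
    simp [site, this]
  · rw [Matrix.diagonal_apply_ne _ hxy]
    simp only [site, Matrix.of_apply]
    split_ifs with h
    · have hk : x k ≠ y k := by
        intro hk
        apply hxy
        funext i
        by_cases hi : i = k
        · rw [hi, hk]
        · exact h i hi
      have : ∀ b b' : Fin 2, b ≠ b' → Pauli.Z.mat b b' = 0 := by
        intro b b'; fin_cases b <;> fin_cases b' <;> simp [Pauli.mat]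
      exact this _ _ hk
    · rfl

/-- `H` is diagonal in the computational basis of the ancillas. -/
theorem ancH_eq_diagonal (M R C : ℕ) (J : ℝ) :
    ancH M R C J = Matrix.diagonal fun y => ((energy M R C J y : ℝ) : ℂ) := by
  ext x y
  by_cases hxy : x = y
  · subst hxy
    simp [ancH, coreH, site_Z, energy, Matrix.add_apply, Matrix.sum_apply, Matrix.sub_apply,
      Matrix.diagonal_mul_diagonal, -Finset.sum_sub_distrib]
  · rw [Matrix.diagonal_apply_ne _ hxy]
    simp [ancH, coreH, site_Z, Matrix.add_apply, Matrix.sum_apply, Matrix.sub_apply,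
      Matrix.diagonal_mul_diagonal, hxy, -Finset.sum_sub_distrib]

/-- The all-zero string is a ground state, of energy `0`. -/
theorem energy_zero (M R C : ℕ) (J : ℝ) : energy M R C J 0 = 0 := by
  simp [energy, zval]

/-- Flipping a single direct ancilla costs exactly `J * C`. -/
theorem energy_single (M R C : ℕ) (J : ℝ) (w : Fin M × Fin R) :
    energy M R C J (Pi.single (Sum.inl w) 1) = J * C := by
  obtain ⟨j₀, i₀⟩ := w
  have h : ∀ (j : Fin M) (i : Fin R),
      (Pi.single (Sum.inl (j₀, i₀)) 1 : Anc M R C → Fin 2) (Sum.inl (j, i)) =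
        if j = j₀ then (if i = i₀ then 1 else 0) else 0 := by
    intro j i
    simp only [Pi.single_apply, Sum.inl.injEq, Prod.mk.injEq]
    split_ifs <;> simp_all
  have h2 : ∀ (j : Fin M) (i : Fin R),
      (C : ℝ) * (1 - zval (if j = j₀ then (if i = i₀ then 1 else 0) else 0)) =
        if j = j₀ then (if i = i₀ then C * 2 else 0) else 0 := by
    intro j i
    split_ifs <;> norm_num [zval]
  have hz : zval 0 = 1 := by simp [zval]
  have h3 : ∀ c : Fin C,
      (Pi.single (Sum.inl (j₀, i₀)) 1 : Anc M R C → Fin 2) (Sum.inr c) = 0 := by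
    intro c; simp
  simp only [energy, h, h3, hz, mul_one, sub_self, Finset.sum_const_zero, mul_zero, add_zero,
    Finset.sum_const, Finset.card_univ, Fintype.card_fin, nsmul_eq_mul, h2]
  simp
  ring

/-- Every other string has energy at least `J * C`: the spectral gap of `H` is `J * C`. -/
theorem energy_ge (M R C : ℕ) (J : ℝ) (hJ : 0 ≤ J) (y : Anc M R C → Fin 2) (hy : y ≠ 0) :
    J * C ≤ energy M R C J y := by
  have hz : ∀ b, zval b = 1 ∨ zval b = -1 := by
    intro b; unfold zval; split_ifs <;> simp
  have hn1 : ∀ b, 0 ≤ 1 - zval b := by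
    intro b; rcases hz b with h | h <;> rw [h] <;> norm_num
  have hn2 : ∀ b b', 0 ≤ 1 - zval b * zval b' := by
    intro b b'; rcases hz b with h | h <;> rcases hz b' with h' | h' <;> rw [h, h'] <;> norm_num
  have hJ2 : 0 ≤ J / 2 := by positivity
  have p1 : 0 ≤ ∑ j : Fin M, ∑ i : Fin R, ∑ c : Fin C,
      (1 - zval (y (Sum.inl (j, i))) * zval (y (Sum.inr c))) :=
    Finset.sum_nonneg fun j _ => Finset.sum_nonneg fun i _ => Finset.sum_nonneg fun c _ => hn2 _ _
  have p2 : 0 ≤ ∑ c : Fin C, (1 - zval (y (Sum.inr c))) := Finset.sum_nonneg fun c _ => hn1 _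
  have p3 : 0 ≤ ∑ c : Fin C, ∑ c' ∈ Finset.Ioi c,
      (1 - zval (y (Sum.inr c)) * zval (y (Sum.inr c'))) :=
    Finset.sum_nonneg fun c _ => Finset.sum_nonneg fun c' _ => hn2 _ _
  by_cases hcore : ∃ c₀ : Fin C, y (Sum.inr c₀) ≠ 0
  · obtain ⟨c₀, hc₀⟩ := hcore
    have hs : zval (y (Sum.inr c₀)) = -1 := by simp [zval, hc₀]
    set s : Fin C → ℝ := fun c => zval (y (Sum.inr c)) with hsdef
    have hs0 : s c₀ = -1 := hs
    have key : ∑ c ∈ Finset.univ.erase c₀, (1 - s c * s c₀) ≤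
        ∑ c : Fin C, ∑ c' ∈ Finset.Ioi c, (1 - s c * s c') := by
      have hsplit : ∑ c ∈ Finset.univ.erase c₀, (1 - s c * s c₀) =
          ∑ c' ∈ Finset.Ioi c₀, (1 - s c₀ * s c') + ∑ c ∈ Finset.Iio c₀, (1 - s c * s c₀) := by
        have hu : Finset.univ.erase c₀ = Finset.Ioi c₀ ∪ Finset.Iio c₀ := by
          ext c
          simp only [Finset.mem_erase, Finset.mem_univ, and_true, Finset.mem_union,
            Finset.mem_Ioi, Finset.mem_Iio]
          exact ⟨fun h => (lt_or_gt_of_ne h).symm, fun h => h.elim ne_of_gt ne_of_lt⟩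
        have hd : Disjoint (Finset.Ioi c₀) (Finset.Iio c₀) := by
          rw [Finset.disjoint_left]
          intro c h1 h2
          exact lt_asymm (Finset.mem_Ioi.1 h1) (Finset.mem_Iio.1 h2)
        rw [hu, Finset.sum_union hd]
        congr 1
        exact Finset.sum_congr rfl fun c _ => by ring
      rw [hsplit, ← Finset.add_sum_erase Finset.univ _ (Finset.mem_univ c₀)]
      gcongr
      calc ∑ c ∈ Finset.Iio c₀, (1 - s c * s c₀)
          ≤ ∑ c ∈ Finset.Iio c₀, ∑ c' ∈ Finset.Ioi c, (1 - s c * s c') := by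
            refine Finset.sum_le_sum fun c hc => ?_
            exact Finset.single_le_sum (f := fun c' => 1 - s c * s c')
              (fun c' _ => hn2 _ _) (Finset.mem_Ioi.2 (Finset.mem_Iio.1 hc))
        _ ≤ ∑ c ∈ Finset.univ.erase c₀, ∑ c' ∈ Finset.Ioi c, (1 - s c * s c') := by
            refine Finset.sum_le_sum_of_subset_of_nonneg (fun c hc => ?_)
              (fun c _ _ => Finset.sum_nonneg fun c' _ => hn2 _ _)
            exact Finset.mem_erase.2 ⟨ne_of_lt (Finset.mem_Iio.1 hc), Finset.mem_univ _⟩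
    have tot : (2 * C : ℝ) = ∑ c : Fin C, (1 - s c) +
        ∑ c ∈ Finset.univ.erase c₀, (1 - s c * s c₀) := by
      rw [← Finset.add_sum_erase Finset.univ (fun c => 1 - s c) (Finset.mem_univ c₀), add_assoc,
        ← Finset.sum_add_distrib, hs0]
      have : ∀ c ∈ Finset.univ.erase c₀, (1 - s c) + (1 - s c * -1) = (2 : ℝ) := by
        intro c _; ring
      rw [Finset.sum_congr rfl this, Finset.sum_const, Finset.card_erase_of_mem (Finset.mem_univ _),
        Finset.card_univ, Fintype.card_fin, nsmul_eq_mul,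
        Nat.cast_sub (Nat.one_le_iff_ne_zero.2 (fun h => by subst h; exact c₀.elim0))]
      push_cast
      ring
    have : (2 * C : ℝ) ≤ ∑ c : Fin C, (1 - s c) +
        ∑ c : Fin C, ∑ c' ∈ Finset.Ioi c, (1 - s c * s c') := by linarith
    have h4 := mul_le_mul_of_nonneg_left this hJ2
    have h5 := mul_nonneg hJ2 p1
    unfold energy
    simp only [hsdef] at h4
    linarith
  · push Not at hcore
    obtain ⟨w, hw⟩ : ∃ w : Fin M × Fin R, y (Sum.inl w) ≠ 0 := by
      by_contra! hcon
      apply hy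
      funext k
      rcases k with w | c
      · exact hcon w
      · exact hcore c
    obtain ⟨j, i⟩ := w
    have hs : zval (y (Sum.inl (j, i))) = -1 := by simp [zval, hw]
    have h6 : (2 * C : ℝ) = ∑ c : Fin C,
        (1 - zval (y (Sum.inl (j, i))) * zval (y (Sum.inr c))) := by
      have hz : zval 0 = 1 := by simp [zval]
      simp only [hs, hcore, hz, mul_one, Finset.sum_const, Finset.card_univ, Fintype.card_fin,
        nsmul_eq_mul]
      ring
    have h7 : (2 * C : ℝ) ≤ ∑ j : Fin M, ∑ i : Fin R, ∑ c : Fin C,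
        (1 - zval (y (Sum.inl (j, i))) * zval (y (Sum.inr c))) := by
      rw [h6]
      refine le_trans ?_ (Finset.single_le_sum (f := fun j => ∑ i : Fin R, ∑ c : Fin C,
        (1 - zval (y (Sum.inl (j, i))) * zval (y (Sum.inr c)))) (fun j _ =>
          Finset.sum_nonneg fun i _ => Finset.sum_nonneg fun c _ => hn2 _ _) (Finset.mem_univ j))
      exact Finset.single_le_sum (f := fun i => ∑ c : Fin C,
        (1 - zval (y (Sum.inl (j, i))) * zval (y (Sum.inr c)))) (fun i _ =>
          Finset.sum_nonneg fun c _ => hn2 _ _) (Finset.mem_univ i)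
    have h4 := mul_le_mul_of_nonneg_left h7 hJ2
    have h5 := mul_nonneg hJ2 p2
    have h8 := mul_nonneg hJ2 p3
    unfold energy
    linarith

/-- The strength of the coupling of the target qubits to the direct ancillas. -/
def beta {n M : ℕ} (T : Target n M) (R C : ℕ) (J : ℝ) (j : Fin M) : ℝ :=
  √(|T.γ j| * (J * C) / (2 * R))

/-- The perturbation `V`. For a negative coupling the factor `A - B` is replaced by `A + B`. -/
def V {n M : ℕ} (T : Target n M) (R C : ℕ) (J : ℝ) : SysOp n M R C :=
  T.Helse ⊗ₖ 1 +
  ∑ j : Fin M, (beta T R C J j : ℂ) • ∑ i : Fin R,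
    (T.opA j - (Real.sign (T.γ j) : ℂ) • T.opB j) ⊗ₖ site Pauli.X (Sum.inl (j, i))

/-- The projector onto the all-zero state of the ancillas. -/
def zeroProj (M R C : ℕ) : Op (Anc M R C) := Matrix.single 0 0 1

/-- The projector `Π_-` onto the subspace `L_-` with all ancillas in the state `0`. -/
def projMinus (n M R C : ℕ) : SysOp n M R C := 1 ⊗ₖ zeroProj M R C

/-- The projector `Π_+` onto the orthogonal complement `L_+`. -/
def projPlus (n M R C : ℕ) : SysOp n M R C := 1 - projMinus n M R C

/-! ### Self-energy -/

section SelfEnergy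

variable {m : Type} [Fintype m] [DecidableEq m]

/-- For a projector `P`: the compression `P A P`, as an operator on the range of `P`, is
invertible. -/
def InvertibleOn (P A : Matrix m m ℂ) : Prop := IsUnit ((1 - P) + P * A * P)

/-- For a projector `P`: the inverse, on the range of `P`, of the compression `P A P`, extended by
zero to the kernel of `P`. -/
def invOn (P A : Matrix m m ℂ) : Matrix m m ℂ := P * ((1 - P) + P * A * P)⁻¹ * P

/-- `invOn P A` is indeed an inverse of the compression, relative to `P`. -/
theorem invOn_spec (P A : Matrix m m ℂ) (hP : P * P = P) (h : InvertibleOn P A) :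
    invOn P A * (P * A * P) = P ∧ (P * A * P) * invOn P A = P := by
  have hdet : IsUnit ((1 - P) + P * A * P).det := (Matrix.isUnit_iff_isUnit_det _).1 h
  set X := (1 - P) + P * A * P with hX
  have h1 : X⁻¹ * X = 1 := Matrix.nonsing_inv_mul _ hdet
  have h2 : X * X⁻¹ = 1 := Matrix.mul_nonsing_inv _ hdet
  have e1 : P * (P * A * P) = X * P := by
    rw [hX, add_mul, sub_mul, one_mul, hP, sub_self, zero_add, ← mul_assoc, ← mul_assoc, hP,
      mul_assoc (P * A) P P, hP]
  have e2 : (P * A * P) * P = P * X := by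
    rw [hX, mul_add, mul_sub, mul_one, hP, sub_self, zero_add, ← mul_assoc, ← mul_assoc, hP,
      mul_assoc (P * A) P P, hP]
  constructor
  · rw [invOn, ← hX, mul_assoc, e1, mul_assoc P, ← mul_assoc X⁻¹, h1, one_mul, hP]
  · rw [invOn, ← hX, ← mul_assoc, ← mul_assoc, e2, mul_assoc P, h2, mul_one, hP]

/-- `G_+(z)`, the resolvent of `H` on the range of `Q` (here `Q` commutes with `H`). -/
def resolventPlus (Q H : Matrix m m ℂ) (z : ℂ) : Matrix m m ℂ := invOn Q (z • 1 - H)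

/-- The term `V_{-+} (G_+ V_+)^(k-2) G_+ V_{+-}` of order `k ≥ 2` in the self-energy expansion,
for the low-energy projector `P`, unperturbed Hamiltonian `H` and perturbation `V`. -/
def selfEnergyTerm (P H V : Matrix m m ℂ) (z : ℂ) (k : ℕ) : Matrix m m ℂ :=
  (P * V * (1 - P)) * (resolventPlus (1 - P) H z * ((1 - P) * V * (1 - P))) ^ (k - 2) *
    resolventPlus (1 - P) H z * ((1 - P) * V * P)

/-- The self-energy expansion `H_- + V_- + ∑_{k ≥ 2} T_k`. -/
def selfEnergySeries (P H V : Matrix m m ℂ) (z : ℂ) : Matrix m m ℂ :=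
  P * H * P + P * V * P + ∑' k : ℕ, selfEnergyTerm P H V z (k + 2)

/-- The self-energy `z - (P (z - H - V)⁻¹ P)⁻¹`, an operator on the range of `P` (extended by
zero). -/
def selfEnergy (P H V : Matrix m m ℂ) (z : ℂ) : Matrix m m ℂ :=
  z • P - invOn P (z • 1 - (H + V))⁻¹

end SelfEnergy

/-- The order-`k` term `T_k` of the self-energy expansion of the gadget. -/
def term {n M : ℕ} (T : Target n M) (R C : ℕ) (J : ℝ) (z : ℂ) (k : ℕ) : SysOp n M R C :=
  selfEnergyTerm (projMinus n M R C) (H n M R C J) (V T R C J) z k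

/-- The effective Hamiltonian `H_targ ⊗ Π_-`, with the overall energy shift `-∑ j, |γ j|` that
comes from the squares of the Pauli operators. -/
def Heff {n M : ℕ} (T : Target n M) (R C : ℕ) : SysOp n M R C :=
  T.Htarg ⊗ₖ zeroProj M R C - ((∑ j, |T.γ j| : ℝ) : ℂ) • projMinus n M R C

end WeakGadget

end

/-! The self-energy is expanded in powers of `V` and compared with its second-order truncation.
Write `Δ = J C`, `S = ∑ |γ j|`, and `P`, `Q` for the projectors `Π_-`, `Π_+`.

Second order is exact. `V` leaves the all-zero state only by flipping one direct ancilla, which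
costs exactly `Δ`, and only the same flip leads back. So `T_2` is `Δ / (z - Δ)` times `∑ |γ j| (1 -
sgn (γ j) A B)`. At `z = 0` this is precisely the target interaction minus `S`. For other `z` the
error carries the factor `z / (z - Δ)`, which is small because `‖z‖` is much smaller than `Δ`
(`term_two_eq`, `Heff_eq`).

Higher orders need a norm of `G_+ V_+` that does not grow with `R`. The triangle inequality over the
`M R` flips would lose a factor of order `√R`. Instead, Cauchy-Schwarz in a C*-algebra bounds a
weighted sum of flips by the square root of its largest row (or column) weight times `√(∑ ‖B w‖²)`,
and the latter is independent of `R` since `β²` is proportional to `1 / R`. A string with `k`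
excited direct ancillas has about `k` relevant flips, but its energy is `k Δ`, so the resolvent
damps each of them by `1 / k` and the weights stay bounded (`sum_stepWeight_up_le`,
`sum_stepWeight_down_le`, `norm_coreStep_le`). This energy count holds only when the core is
unexcited, and `V` never touches the core, so the expansion stays in that sector (`liftTerm_eq`).
The result is geometric decay with ratio `q`. The tail from order three is of size `Δ q³`,
comparable to `γ_max M q`, and `M³ ≤ κ ε² Δ` makes `M q` of order `ε`.

The identification with the exact self-energy is a Schur complement: the summed series solves the
high-energy block of the resolvent equation (`mul_add_tsum_liftTerm`). -/

noncomputable section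

namespace WeakGadget

/-! ### Operator norms -/

section CStar

open scoped CStarAlgebra

/-- The Cauchy-Schwarz inequality for finite families in a C*-algebra. -/
theorem norm_sum_mul_sq_le {E ι : Type*} [CStarAlgebra E] [PartialOrder E] [StarOrderedRing E]
    [Fintype ι] (X Y : ι → E) :
    ‖∑ i, X i * Y i‖ ^ 2 ≤ ‖∑ i, X i * star (X i)‖ * ‖∑ i, star (Y i) * Y i‖ := by
  -- In the Hilbert C*-module of families, the vector of adjoints of `Y` is paired with `X`, so that
  -- the inner product is the sum to be bounded.
  let x : WithCStarModule E (ι → E) := (WithCStarModule.equiv E (ι → E)).symm fun i => star (Y i)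
  let y : WithCStarModule E (ι → E) := (WithCStarModule.equiv E (ι → E)).symm X
  have h := CStarModule.norm_inner_le (A := E) (WithCStarModule E (ι → E)) (x := x) (y := y)
  have h1 : ‖x‖ ^ 2 = ‖∑ i, star (Y i) * Y i‖ := by
    rw [WithCStarModule.pi_norm_sq]
    simp [x, WithCStarModule.inner_def]
  have h2 : ‖y‖ ^ 2 = ‖∑ i, X i * star (X i)‖ := by
    rw [WithCStarModule.pi_norm_sq]
    simp [y, WithCStarModule.inner_def]
  have h3 : inner E x y = ∑ i, X i * Y i := by
    rw [WithCStarModule.pi_inner]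
    simp [x, y, WithCStarModule.inner_def]
  rw [h3] at h
  calc ‖∑ i, X i * Y i‖ ^ 2 ≤ (‖x‖ * ‖y‖) ^ 2 := by gcongr
    _ = _ := by rw [mul_pow, h1, h2, mul_comm]

end CStar

section MatrixNorm

variable {l m : Type} [Fintype l] [DecidableEq l] [Fintype m] [DecidableEq m]

open scoped MatrixOrder in
theorem norm_sum_mul_sq_le_matrix {ι : Type*} [Fintype ι] (X Y : ι → Matrix m m ℂ) :
    ‖∑ i, X i * Y i‖ ^ 2 ≤
      ‖∑ i, X i * (X i).conjTranspose‖ * ‖∑ i, (Y i).conjTranspose * Y i‖ :=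
  norm_sum_mul_sq_le X Y

/-- Tensoring with the identity does not increase the operator norm. -/
theorem norm_kronecker_one_le (A : Matrix l l ℂ) : ‖A ⊗ₖ (1 : Matrix m m ℂ)‖ ≤ ‖A‖ := by
  -- A star homomorphism between C*-algebras is automatically contractive.
  let φ : Matrix l l ℂ →⋆ₙₐ[ℂ] Matrix (l × m) (l × m) ℂ :=
    { toFun := fun A => A ⊗ₖ (1 : Matrix m m ℂ)
      map_smul' := fun r A => Matrix.smul_kronecker r A _
      map_zero' := Matrix.zero_kronecker _
      map_add' := fun A B => Matrix.add_kronecker A B _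
      map_mul' := fun A B => by rw [← Matrix.mul_kronecker_mul, one_mul]
      map_star' := fun A => by
        simp [Matrix.star_eq_conjTranspose, Matrix.conjTranspose_kronecker] }
  exact NonUnitalStarAlgHom.norm_apply_le φ A

theorem norm_one_kronecker_diagonal_le (f : m → ℂ) {b : ℝ} (hb : 0 ≤ b) (hf : ∀ y, ‖f y‖ ≤ b) :
    ‖(1 : Matrix l l ℂ) ⊗ₖ Matrix.diagonal f‖ ≤ b := by
  rw [← Matrix.diagonal_one, Matrix.diagonal_kronecker_diagonal, Matrix.l2_opNorm_diagonal]
  exact (pi_norm_le_iff_of_nonneg hb).2 fun y => by simpa using hf y.2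

theorem norm_kronecker_diagonal_le (A : Matrix l l ℂ) (f : m → ℂ) {b : ℝ} (hb : 0 ≤ b)
    (hf : ∀ y, ‖f y‖ ≤ b) : ‖A ⊗ₖ Matrix.diagonal f‖ ≤ ‖A‖ * b := by
  have h : A ⊗ₖ Matrix.diagonal f = (A ⊗ₖ (1 : Matrix m m ℂ)) * (1 ⊗ₖ Matrix.diagonal f) := by
    rw [← Matrix.mul_kronecker_mul, one_mul, mul_one]
  rw [h]
  exact (norm_mul_le _ _).trans
    (mul_le_mul (norm_kronecker_one_le A) (norm_one_kronecker_diagonal_le f hb hf)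
      (norm_nonneg _) (norm_nonneg _))

theorem norm_le_one_of_conjTranspose_mul_self (A : Matrix m m ℂ) (h : A.conjTranspose * A = 1) :
    ‖A‖ ≤ 1 := by
  have h1 : ‖(1 : Matrix m m ℂ)‖ ≤ 1 := by
    rw [← Matrix.diagonal_one, Matrix.l2_opNorm_diagonal]
    exact (pi_norm_le_iff_of_nonneg zero_le_one).2 fun y => by simp
  have h2 := Matrix.l2_opNorm_conjTranspose_mul_self A
  rw [h] at h2
  nlinarith [norm_nonneg A]

end MatrixNorm

/-! ### The self-energy series and the Schur complement -/

section Schur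

variable {m : Type} [Fintype m] [DecidableEq m]

/-- The vector of order `k` in the expansion of the high-energy component of a state. -/
def liftTerm (P H V : Matrix m m ℂ) (z : ℂ) (k : ℕ) : Matrix m m ℂ :=
  (resolventPlus (1 - P) H z * ((1 - P) * V * (1 - P))) ^ k *
    (resolventPlus (1 - P) H z * ((1 - P) * V * P))

theorem selfEnergyTerm_add_two (P H V : Matrix m m ℂ) (z : ℂ) (k : ℕ) :
    selfEnergyTerm P H V z (k + 2) = P * V * (1 - P) * liftTerm P H V z k := by
  simp only [selfEnergyTerm, liftTerm, Nat.add_sub_cancel, mul_assoc]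

variable {P H V : Matrix m m ℂ} {z : ℂ}

theorem selfEnergySeries_eq (hHP : H * P = 0) (hs : Summable (liftTerm P H V z)) :
    selfEnergySeries P H V z =
      P * V * P + P * V * (1 - P) * ∑' k, liftTerm P H V z k := by
  simp only [selfEnergySeries, selfEnergyTerm_add_two]
  rw [hs.tsum_mul_left, mul_assoc P H P, hHP, mul_zero, zero_add]

/-- The sum `Y` of the lift terms is a fixed point of `Y = G V P + G V_+ Y`. This says that `z - H -
V` maps `P + Y` to something without high-energy component, and what is left in the low-energy block
is `z - Σ`. -/
theorem mul_add_tsum_liftTerm (hP : P * P = P) (hPH : P * H = 0) (hHP : H * P = 0)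
    (hinv : InvertibleOn (1 - P) (z • 1 - H)) (hs : Summable (liftTerm P H V z)) :
    (z • 1 - (H + V)) * (P + ∑' k, liftTerm P H V z k) =
      z • P - selfEnergySeries P H V z ∧ P * ∑' k, liftTerm P H V z k = 0 := by
  have hQ : (1 - P) * (1 - P) = 1 - P := by
    simp [mul_sub, sub_mul, hP]
  have hPQ : P * (1 - P) = 0 := by rw [mul_sub, hP]; simp
  rw [selfEnergySeries_eq hHP hs]
  set Y := ∑' k, liftTerm P H V z k with hY
  set G := resolventPlus (1 - P) H z with hG
  have hPG : P * G = 0 := by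
    rw [hG, resolventPlus, invOn, ← mul_assoc, ← mul_assoc, hPQ, zero_mul, zero_mul]
  have hspec : ((1 - P) * (z • 1 - H) * (1 - P)) * G = 1 - P := (invOn_spec _ _ hQ hinv).2
  have hrec : Y = G * ((1 - P) * V * P) + G * ((1 - P) * V * (1 - P)) * Y := by
    have h1 : ∀ k, liftTerm P H V z (k + 1) =
        G * ((1 - P) * V * (1 - P)) * liftTerm P H V z k := by
      intro k
      simp only [liftTerm, ← hG, pow_succ', mul_assoc]
    conv_lhs => rw [hY, hs.tsum_eq_zero_add]
    simp only [h1]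
    rw [hs.tsum_mul_left, ← hY]
    simp [liftTerm, ← hG]
  have hPY : P * Y = 0 := by
    rw [hrec, mul_add, mul_assoc G, ← mul_assoc P G, ← mul_assoc P G, hPG]; simp
  have hQY : (1 - P) * Y = Y := by rw [sub_mul, hPY]; simp
  -- Applying `Q (z - H) Q` to the fixed-point equation cancels the resolvent `G`.
  have hhigh : (1 - P) * (z • 1 - H) * Y = (1 - P) * V * P + (1 - P) * V * Y := by
    have h2 : (1 - P) * (z • 1 - H) * Y = ((1 - P) * (z • 1 - H) * (1 - P)) * Y := by
      rw [mul_assoc _ (1 - P) Y, hQY]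
    rw [h2]
    conv_lhs => rw [hrec]
    rw [mul_add, mul_assoc G, ← mul_assoc _ G, ← mul_assoc _ G, hspec]
    simp only [← mul_assoc, hQ]
    rw [mul_assoc _ (1 - P) Y, hQY]
  refine ⟨?_, hPY⟩
  have hQH : (1 - P) * H = H := by rw [sub_mul, hPH]; simp
  have h3 : z • Y - H * Y = (1 - P) * V * P + (1 - P) * V * Y := by
    rw [← hhigh, mul_sub, hQH, sub_mul, mul_smul_comm, mul_one, smul_mul_assoc, hQY]
  have h4 : (z • 1 - (H + V)) * (P + Y) = z • P - V * P - V * Y + (z • Y - H * Y) := by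
    rw [mul_add, sub_mul, sub_mul, add_mul, add_mul, hHP]
    simp only [smul_mul_assoc, one_mul]
    abel
  rw [h4, h3, mul_assoc (P * V), hQY]
  simp only [sub_mul, one_mul]
  abel

/-- Schur complement: a convergent self-energy series sums up to the self-energy. -/
theorem selfEnergySeries_eq_selfEnergy (hP : P * P = P) (hPH : P * H = 0) (hHP : H * P = 0)
    (hinv : InvertibleOn (1 - P) (z • 1 - H)) (hs : Summable (liftTerm P H V z))
    (hunit : IsUnit (z • 1 - (H + V))) :
    InvertibleOn P (z • 1 - (H + V))⁻¹ ∧ selfEnergySeries P H V z = selfEnergy P H V z := by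
  obtain ⟨h1, h2⟩ := mul_add_tsum_liftTerm hP hPH hHP hinv hs
  have hser := selfEnergySeries_eq hHP hs
  set A := z • 1 - (H + V) with hA
  set Y := ∑' k, liftTerm P H V z k with hY
  set E := z • P - selfEnergySeries P H V z with hE
  have hYP : Y * P = Y := by
    rw [hY, ← hs.tsum_mul_right]
    congr 1
    funext k
    simp only [liftTerm, mul_assoc, hP]
  have hPE : P * E = E := by
    rw [hE, hser, mul_sub, mul_add, mul_smul_comm]; simp only [← mul_assoc, hP]
  have hEP : E * P = E := by
    rw [hE, hser, sub_mul, add_mul, smul_mul_assoc, mul_assoc _ P P, mul_assoc _ Y P, hP, hYP]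
  have hPQ : P * (1 - P) = 0 := by rw [mul_sub, hP]; simp
  have hQE : (1 - P) * E = 0 := by rw [sub_mul, hPE]; simp
  have hQQ : (1 - P) * (1 - P) = 1 - P := by simp [mul_sub, sub_mul, hP]
  have hdet : IsUnit A.det := (Matrix.isUnit_iff_isUnit_det _).1 hunit
  have h3 : P + Y = A⁻¹ * E := by
    rw [← h1, ← mul_assoc, Matrix.nonsing_inv_mul _ hdet, one_mul]
  have h4 : P * A⁻¹ * P * E = P := by
    rw [mul_assoc _ P E, hPE, mul_assoc, ← h3, mul_add, h2, hP, add_zero]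
  -- Block inverse: `E = z P - Σ` inverts `P A⁻¹ P` on the range of `P`, and the complement carries
  -- the identity.
  have h5 : ((1 - P) + P * A⁻¹ * P) * ((1 - P) + E) = 1 := by
    rw [add_mul, mul_add, mul_add, hQE, hQQ, h4, mul_assoc _ P (1 - P), hPQ]
    simp
  have h6 : ((1 - P) + P * A⁻¹ * P)⁻¹ = (1 - P) + E := Matrix.inv_eq_right_inv h5
  refine ⟨?_, ?_⟩
  · exact (Matrix.isUnit_iff_isUnit_det _).2 (Matrix.isUnit_det_of_right_inverse h5)
  · rw [selfEnergy, ← hA, invOn, h6, mul_add, hPQ, zero_add, hPE, hEP, hE]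
    abel

end Schur

/-! ### Algebra of single-qubit operators -/

section Site

set_option linter.unusedSectionVars false

variable {ι : Type} [Fintype ι] [DecidableEq ι]

theorem eq_update_of_forall_ne {x z : ι → Fin 2} {k : ι} (h : ∀ i, i ≠ k → x i = z i) :
    z = Function.update x k (z k) := by
  funext i
  by_cases hi : i = k
  · subst hi; simp
  · rw [Function.update_of_ne hi, h i hi]

theorem site_apply (P : Pauli) (k : ι) (x y : ι → Fin 2) :
    site P k x y = if ∀ i, i ≠ k → x i = y i then P.mat (x k) (y k) else 0 := rfl

/-- A row of a single-qubit operator is supported on the two strings that agree with `x` off `k`, so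
products reduce to 2-by-2 matrices. -/
theorem sum_site_mul (P : Pauli) (k : ι) (x : ι → Fin 2) (g : (ι → Fin 2) → ℂ) :
    ∑ z, site P k x z * g z = ∑ b : Fin 2, P.mat (x k) b * g (Function.update x k b) := by
  have hinj : Function.Injective fun b : Fin 2 => Function.update x k b := by
    intro b b' h
    simpa using congrFun h k
  calc ∑ z, site P k x z * g z
      = ∑ z ∈ Finset.univ.image fun b : Fin 2 => Function.update x k b, site P k x z * g z := by
        symm
        refine Finset.sum_subset (Finset.subset_univ _) fun z _ hz => ?_
        rw [site_apply, if_neg, zero_mul]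
        intro h
        exact hz (Finset.mem_image.2 ⟨z k, Finset.mem_univ _, (eq_update_of_forall_ne h).symm⟩)
    _ = ∑ b : Fin 2, site P k x (Function.update x k b) * g (Function.update x k b) :=
        Finset.sum_image fun b _ b' _ h => hinj h
    _ = _ := by
        refine Finset.sum_congr rfl fun b _ => ?_
        rw [site_apply, if_pos, Function.update_self]
        intro i hi
        rw [Function.update_of_ne hi]

theorem pauli_mat_mul_self (P : Pauli) : P.mat * P.mat = 1 := by
  cases P <;> ext i j <;> fin_cases i <;> fin_cases j <;> simp [Pauli.mat, Matrix.mul_apply]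

theorem pauli_mat_conjTranspose (P : Pauli) : P.mat.conjTranspose = P.mat := by
  cases P <;> ext i j <;> fin_cases i <;> fin_cases j <;> simp [Pauli.mat]

theorem site_mul_self (P : Pauli) (k : ι) : site P k * site P k = 1 := by
  ext x y
  rw [Matrix.mul_apply, sum_site_mul P k x fun z => site P k z y]
  have h : ∀ b, site P k (Function.update x k b) y =
      if ∀ i, i ≠ k → x i = y i then P.mat b (y k) else 0 := by
    intro b
    rw [site_apply]
    refine if_congr (forall_congr' fun i => imp_congr_right fun hi => ?_) (by simp) rfl
    rw [Function.update_of_ne hi]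
  simp only [h]
  split_ifs with hxy
  · rw [← Matrix.mul_apply, pauli_mat_mul_self, Matrix.one_apply, Matrix.one_apply]
    refine if_congr ⟨fun hk => ?_, fun h => by rw [h]⟩ rfl rfl
    funext i
    by_cases hi : i = k
    · rw [hi, hk]
    · exact hxy i hi
  · rw [Matrix.one_apply_ne (fun h => hxy fun i _ => by rw [h])]
    simp

theorem site_conjTranspose (P : Pauli) (k : ι) : (site P k).conjTranspose = site P k := by
  ext x y
  rw [Matrix.conjTranspose_apply, site_apply, site_apply]
  by_cases h : ∀ i, i ≠ k → x i = y i
  · rw [if_pos h, if_pos fun i hi => (h i hi).symm]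
    exact congrFun (congrFun (pauli_mat_conjTranspose P) (x k)) (y k)
  · rw [if_neg h, if_neg fun h' => h fun i hi => (h' i hi).symm, star_zero]

/-- The intermediate string is forced: it has bit `k` from `y` and all other bits from `x`. The
resulting formula is symmetric in the two sites, which gives commutation. -/
theorem site_mul_site_apply (P P' : Pauli) {k l : ι} (hkl : k ≠ l) (x y : ι → Fin 2) :
    (site P k * site P' l) x y =
      if ∀ i, i ≠ k → i ≠ l → x i = y i then P.mat (x k) (y k) * P'.mat (x l) (y l) else 0 := by
  rw [Matrix.mul_apply, sum_site_mul P k x fun z => site P' l z y,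
    Finset.sum_eq_single (y k)]
  · rw [site_apply, Function.update_of_ne hkl.symm]
    have : (∀ i, i ≠ l → Function.update x k (y k) i = y i) ↔
        ∀ i, i ≠ k → i ≠ l → x i = y i := by
      refine forall_congr' fun i => ?_
      by_cases hi : i = k
      · subst hi; simp
      · simp [hi]
    simp only [this, mul_ite, mul_zero]
  · intro b _ hb
    rw [site_apply, if_neg, mul_zero]
    intro h
    exact hb (by simpa using h k hkl)
  · simp

theorem site_commute (P P' : Pauli) {k l : ι} (hkl : k ≠ l) :
    site P k * site P' l = site P' l * site P k := by
  ext x y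
  rw [site_mul_site_apply P P' hkl, site_mul_site_apply P' P hkl.symm, mul_comm (P.mat _ _)]
  exact if_congr (forall_congr' fun i => ⟨fun h a b => h b a, fun h a b => h b a⟩) rfl rfl

theorem norm_site_le (P : Pauli) (k : ι) : ‖site P k‖ ≤ 1 :=
  norm_le_one_of_conjTranspose_mul_self _ (by rw [site_conjTranspose, site_mul_self])

/-! ### Bit flips -/

/-- Flip the bit `k` of the string `x`. -/
def flipBit (k : ι) (x : ι → Fin 2) : ι → Fin 2 := Function.update x k (1 + x k)

theorem flipBit_self (k : ι) (x : ι → Fin 2) : flipBit k x k = 1 + x k := by simp [flipBit]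

theorem flipBit_of_ne {k i : ι} (h : i ≠ k) (x : ι → Fin 2) : flipBit k x i = x i := by simp [flipBit, h]

theorem flipBit_flipBit (k : ι) (x : ι → Fin 2) : flipBit k (flipBit k x) = x := by
  have : ∀ b : Fin 2, 1 + (1 + b) = b := by decide
  simp [flipBit, this]

theorem site_X_apply (k : ι) (x y : ι → Fin 2) :
    site Pauli.X k x y = if y = flipBit k x then 1 else 0 := by
  have hX : ∀ b b' : Fin 2, Pauli.X.mat b b' = if b' = 1 + b then 1 else 0 := by
    intro b b'
    fin_cases b <;> fin_cases b' <;> simp [Pauli.mat]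
  rw [site_apply, hX]
  by_cases h : y = flipBit k x
  · subst h
    rw [if_pos fun i hi => (flipBit_of_ne hi x).symm, if_pos (flipBit_self k x), if_pos rfl]
  · rw [if_neg h]
    split_ifs with h1 h2
    · exact absurd (by rw [eq_update_of_forall_ne h1, h2]; rfl) h
    · rfl
    · rfl

/-- Lets all diagonal factors be collected to the left of the flips, so that products with
projectors and resolvents only change the weights of a `ladder`. -/
theorem site_X_mul_diagonal (k : ι) (f : (ι → Fin 2) → ℂ) :
    site Pauli.X k * Matrix.diagonal f =
      Matrix.diagonal (fun x => f (flipBit k x)) * site Pauli.X k := by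
  ext x y
  rw [Matrix.mul_diagonal, Matrix.diagonal_mul, site_X_apply]
  split_ifs with h
  · rw [h]; ring
  · ring

/-! ### Weighted sums of bit flips -/

section Ladder

variable {l W : Type} [Fintype l] [DecidableEq l] [Fintype W]

/-- The operator `∑ w, B w ⊗ (f w) X_{s w}`, where `f w` is a diagonal operator. -/
def ladder (B : W → Matrix l l ℂ) (s : W → ι) (f : W → (ι → Fin 2) → ℂ) :
    Matrix (l × (ι → Fin 2)) (l × (ι → Fin 2)) ℂ :=
  ∑ w, B w ⊗ₖ (Matrix.diagonal (f w) * site Pauli.X (s w))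

variable (B : W → Matrix l l ℂ) (s : W → ι) (f f' : W → (ι → Fin 2) → ℂ)

theorem ladder_add :
    ladder B s (fun w y => f w y + f' w y) = ladder B s f + ladder B s f' := by
  simp only [ladder, ← Finset.sum_add_distrib, ← Matrix.kronecker_add, ← add_mul,
    Matrix.diagonal_add]

theorem one_kronecker_diagonal_mul_ladder (g : (ι → Fin 2) → ℂ) :
    (1 ⊗ₖ Matrix.diagonal g) * ladder B s f = ladder B s fun w y => g y * f w y := by
  simp only [ladder, Finset.mul_sum, ← Matrix.mul_kronecker_mul, one_mul, ← mul_assoc,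
    Matrix.diagonal_mul_diagonal]

theorem ladder_mul_one_kronecker_diagonal (g : (ι → Fin 2) → ℂ) :
    ladder B s f * (1 ⊗ₖ Matrix.diagonal g) =
      ladder B s fun w y => f w y * g (flipBit (s w) y) := by
  simp only [ladder, Finset.sum_mul, ← Matrix.mul_kronecker_mul, mul_one, mul_assoc,
    site_X_mul_diagonal]
  simp only [← mul_assoc, Matrix.diagonal_mul_diagonal]

variable {B s f}

theorem norm_sum_conjTranspose_mul_self_le {m : Type} [Fintype m] [DecidableEq m]
    (B : W → Matrix m m ℂ) {b : W → ℝ} (hB : ∀ w, ‖B w‖ ≤ b w) :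
    ‖∑ w, (B w).conjTranspose * B w‖ ≤ ∑ w, b w ^ 2 := by
  refine (norm_sum_le _ _).trans (Finset.sum_le_sum fun w _ => ?_)
  rw [Matrix.l2_opNorm_conjTranspose_mul_self, ← sq]
  exact pow_le_pow_left₀ (norm_nonneg _) (hB w) 2

/-- A bound for weighted sums of bit flips, by the weights of the rows. -/
theorem norm_ladder_sq_le {b : W → ℝ} (hB : ∀ w, ‖B w‖ ≤ b w) {t : ℝ} (ht : 0 ≤ t)
    (hf : ∀ y, ∑ w, ‖f w y‖ ^ 2 ≤ t) : ‖ladder B s f‖ ^ 2 ≤ t * ∑ w, b w ^ 2 := by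
  -- Each summand factors into an ancilla part times a target part. Since `X² = 1`, the ancilla
  -- parts give the diagonal operator of row weights.
  have h := norm_sum_mul_sq_le_matrix
    (fun w => (1 : Matrix l l ℂ) ⊗ₖ (Matrix.diagonal (f w) * site Pauli.X (s w)))
    (fun w => B w ⊗ₖ (1 : Op ι))
  have h1 : ∑ w, (1 : Matrix l l ℂ) ⊗ₖ (Matrix.diagonal (f w) * site Pauli.X (s w)) *
      B w ⊗ₖ (1 : Op ι) = ladder B s f := by
    simp only [ladder, ← Matrix.mul_kronecker_mul, one_mul, mul_one]
  have h2 : ∑ w, (1 : Matrix l l ℂ) ⊗ₖ (Matrix.diagonal (f w) * site Pauli.X (s w)) *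
      ((1 : Matrix l l ℂ) ⊗ₖ (Matrix.diagonal (f w) * site Pauli.X (s w))).conjTranspose =
      1 ⊗ₖ Matrix.diagonal fun y => ((∑ w, ‖f w y‖ ^ 2 : ℝ) : ℂ) := by
    have h3 : ∀ w, Matrix.diagonal (f w) * site Pauli.X (s w) *
        (Matrix.diagonal (f w) * site Pauli.X (s w)).conjTranspose =
        Matrix.diagonal fun y => ((‖f w y‖ ^ 2 : ℝ) : ℂ) := by
      intro w
      rw [Matrix.conjTranspose_mul, site_conjTranspose, mul_assoc, ← mul_assoc (site _ _),
        site_mul_self, one_mul, Matrix.diagonal_conjTranspose, Matrix.diagonal_mul_diagonal]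
      congr 1
      funext y
      simp [Complex.mul_conj']
    simp only [Matrix.conjTranspose_kronecker, ← Matrix.mul_kronecker_mul,
      Matrix.conjTranspose_one, one_mul, h3]
    ext x y
    simp only [Matrix.sum_apply, Matrix.kroneckerMap_apply, ← Finset.mul_sum]
    congr 1
    by_cases hxy : x.2 = y.2
    · simp [hxy]
    · simp [Matrix.diagonal_apply_ne _ hxy]
  rw [h1, h2] at h
  refine h.trans (mul_le_mul ?_ ?_ (norm_nonneg _) ht)
  · refine norm_one_kronecker_diagonal_le _ ht fun y => ?_
    rw [Complex.norm_real, Real.norm_of_nonneg (Finset.sum_nonneg fun w _ => sq_nonneg _)]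
    exact hf y
  · exact norm_sum_conjTranspose_mul_self_le _ fun w => (norm_kronecker_one_le _).trans (hB w)

theorem ladder_conjTranspose :
    (ladder B s f).conjTranspose =
      ladder (fun w => (B w).conjTranspose) s fun w y => star (f w (flipBit (s w) y)) := by
  simp only [ladder, Matrix.conjTranspose_sum, Matrix.conjTranspose_kronecker,
    Matrix.conjTranspose_mul, site_conjTranspose, Matrix.diagonal_conjTranspose,
    site_X_mul_diagonal, Pi.star_apply]

/-- A bound for weighted sums of bit flips, by the weights of the columns. -/
theorem norm_ladder_sq_le' {b : W → ℝ} (hB : ∀ w, ‖B w‖ ≤ b w) {t : ℝ} (ht : 0 ≤ t)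
    (hf : ∀ y, ∑ w, ‖f w (flipBit (s w) y)‖ ^ 2 ≤ t) : ‖ladder B s f‖ ^ 2 ≤ t * ∑ w, b w ^ 2 := by
  rw [← Matrix.l2_opNorm_conjTranspose, ladder_conjTranspose]
  refine norm_ladder_sq_le (fun w => ?_) ht fun y => ?_
  · rw [Matrix.l2_opNorm_conjTranspose]; exact hB w
  · simpa using hf y

end Ladder

end Site

/-! ### The gadget in terms of bit flips -/

section AncDiag

variable {n M R C : ℕ}

/-- An operator which is diagonal on the ancillas and trivial on the target register. -/
def ancDiag (n : ℕ) {M R C : ℕ} (f : (Anc M R C → Fin 2) → ℂ) : SysOp n M R C :=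
  1 ⊗ₖ Matrix.diagonal f

variable (f g : (Anc M R C → Fin 2) → ℂ)

theorem ancDiag_mul : ancDiag n f * ancDiag n g = ancDiag n fun y => f y * g y := by
  simp only [ancDiag, ← Matrix.mul_kronecker_mul, one_mul, Matrix.diagonal_mul_diagonal]

theorem ancDiag_one : ancDiag n (fun _ : Anc M R C → Fin 2 => 1) = 1 := by
  simp [ancDiag]

theorem ancDiag_add : ancDiag n f + ancDiag n g = ancDiag n fun y => f y + g y := by
  simp only [ancDiag, ← Matrix.kronecker_add, Matrix.diagonal_add]

theorem ancDiag_sub : ancDiag n f - ancDiag n g = ancDiag n fun y => f y - g y := by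
  rw [sub_eq_iff_eq_add, ancDiag_add]; simp

theorem ancDiag_smul (z : ℂ) : z • ancDiag n f = ancDiag n fun y => z * f y := by
  rw [ancDiag, ← Matrix.kronecker_smul, ← Matrix.diagonal_smul]; rfl

theorem zeroProj_eq : zeroProj M R C = Matrix.diagonal fun y => if y = 0 then 1 else 0 := by
  rw [zeroProj]
  ext x y
  rw [Matrix.single_apply, Matrix.diagonal_apply]
  by_cases hx : x = 0
  · by_cases hy : y = 0
    · simp [hx, hy]
    · simp [hx, Ne.symm hy]
  · simp [hx, Ne.symm hx]

theorem projMinus_eq : projMinus n M R C = ancDiag n fun y => if y = 0 then 1 else 0 := by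
  rw [projMinus, zeroProj_eq, ancDiag]

theorem one_sub_projMinus_eq :
    1 - projMinus n M R C = ancDiag n fun y => if y = 0 then 0 else 1 := by
  rw [projMinus_eq, ← ancDiag_one, ancDiag_sub]
  congr 1
  funext y
  split_ifs <;> simp

theorem H_eq (J : ℝ) : H n M R C J = ancDiag n fun y => ((energy M R C J y : ℝ) : ℂ) := by
  rw [H, ancH_eq_diagonal, ancDiag]

theorem projMinus_mul_self : projMinus n M R C * projMinus n M R C = projMinus n M R C := by
  rw [projMinus_eq, ancDiag_mul]; congr 1; funext y; split_ifs <;> simp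

theorem projMinus_mul_H (J : ℝ) : projMinus n M R C * H n M R C J = 0 := by
  rw [projMinus_eq, H_eq, ancDiag_mul]
  have : (fun y : Anc M R C → Fin 2 =>
      (if y = 0 then (1 : ℂ) else 0) * ((energy M R C J y : ℝ) : ℂ)) = fun _ => 0 := by
    funext y
    split_ifs with h
    · rw [h, energy_zero]; simp
    · simp
  rw [this]; simp [ancDiag]

theorem H_mul_projMinus (J : ℝ) : H n M R C J * projMinus n M R C = 0 := by
  rw [← projMinus_mul_H (n := n) (M := M) (R := R) (C := C) J, projMinus_eq, H_eq, ancDiag_mul,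
    ancDiag_mul]
  simp only [mul_comm]

/-- The resolvent of `H` on the high-energy subspace, as a function of the ancilla string. -/
def green (M R C : ℕ) (J : ℝ) (z : ℂ) (y : Anc M R C → Fin 2) : ℂ :=
  if y = 0 then 0 else (z - (energy M R C J y : ℝ))⁻¹

variable {J : ℝ} {z : ℂ}

theorem energy_sub_norm_le (y : Anc M R C → Fin 2) :
    energy M R C J y - ‖z‖ ≤ ‖z - (energy M R C J y : ℝ)‖ := by
  have h := norm_sub_norm_le ((energy M R C J y : ℝ) : ℂ) z
  rw [norm_sub_rev, Complex.norm_real] at h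
  exact (sub_le_sub_right (le_abs_self _) _).trans h

theorem compression_eq :
    (1 - (1 - projMinus n M R C)) +
      (1 - projMinus n M R C) * (z • 1 - H n M R C J) * (1 - projMinus n M R C) =
    ancDiag n fun y => if y = 0 then 1 else z - (energy M R C J y : ℝ) := by
  rw [one_sub_projMinus_eq, H_eq, ← ancDiag_one, ancDiag_smul, ancDiag_sub, ancDiag_sub,
    ancDiag_mul, ancDiag_mul, ancDiag_add]
  congr 1
  funext y
  split_ifs <;> simp

theorem compression_mul_inv (hJ : 0 ≤ J) (hz : ‖z‖ < J * C) :
    (ancDiag n fun y : Anc M R C → Fin 2 => if y = 0 then 1 else z - (energy M R C J y : ℝ)) *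
      (ancDiag n fun y => if y = 0 then 1 else (z - (energy M R C J y : ℝ))⁻¹) = 1 := by
  rw [ancDiag_mul, ← ancDiag_one]
  congr 1
  funext y
  split_ifs with h
  · simp
  · refine mul_inv_cancel₀ (norm_pos_iff.1 ?_)
    have h1 := energy_ge M R C J hJ y h
    have h2 := energy_sub_norm_le (J := J) (z := z) y
    linarith

theorem invertibleOn_projPlus (hJ : 0 ≤ J) (hz : ‖z‖ < J * C) :
    InvertibleOn (1 - projMinus n M R C) (z • 1 - H n M R C J) := by
  rw [InvertibleOn, compression_eq]
  exact (Matrix.isUnit_iff_isUnit_det _).2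
    (Matrix.isUnit_det_of_right_inverse (compression_mul_inv hJ hz))

theorem resolventPlus_eq (hJ : 0 ≤ J) (hz : ‖z‖ < J * C) :
    resolventPlus (1 - projMinus n M R C) (H n M R C J) z = ancDiag n (green M R C J z) := by
  rw [resolventPlus, invOn, compression_eq, Matrix.inv_eq_right_inv (compression_mul_inv hJ hz),
    one_sub_projMinus_eq, ancDiag_mul, ancDiag_mul]
  congr 1
  funext y
  rw [green]
  split_ifs <;> simp

end AncDiag

/-! ### Blocks of the perturbation and excitation counting -/

section Coupling

variable {n M : ℕ} (T : Target n M) (R C : ℕ) (J : ℝ)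

/-- The operator on the target register that is coupled to a direct ancilla. -/
def coupling (w : Fin M × Fin R) : Op (Fin n) :=
  (beta T R C J w.1 : ℂ) • (T.opA w.1 - (Real.sign (T.γ w.1) : ℂ) • T.opB w.1)

/-- The coupling to the direct ancillas, with weights depending on the ancilla string. -/
def flips (f : Fin M × Fin R → (Anc M R C → Fin 2) → ℂ) : SysOp n M R C :=
  ladder (coupling T R C J) Sum.inl f

theorem V_eq :
    V T R C J = T.Helse ⊗ₖ Matrix.diagonal (fun _ => 1) + flips T R C J (fun _ _ => 1) := by
  rw [V, flips, ladder, Fintype.sum_prod_type, Matrix.diagonal_one]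
  simp only [coupling, Finset.smul_sum, Matrix.smul_kronecker, one_mul]

theorem ancDiag_mul_flips_mul_ancDiag (f g : (Anc M R C → Fin 2) → ℂ)
    (k : Fin M × Fin R → (Anc M R C → Fin 2) → ℂ) :
    ancDiag n f * flips T R C J k * ancDiag n g =
      flips T R C J fun w y => f y * k w y * g (flipBit (Sum.inl w) y) := by
  rw [flips, ancDiag, one_kronecker_diagonal_mul_ladder, ancDiag,
    ladder_mul_one_kronecker_diagonal, flips]

theorem ancDiag_mul_V_mul_ancDiag (f g : (Anc M R C → Fin 2) → ℂ) :
    ancDiag n f * V T R C J * ancDiag n g =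
      T.Helse ⊗ₖ Matrix.diagonal (fun y => f y * g y) +
        flips T R C J fun w y => f y * g (flipBit (Sum.inl w) y) := by
  rw [V_eq, mul_add, add_mul, ancDiag_mul_flips_mul_ancDiag]
  simp only [ancDiag, ← Matrix.mul_kronecker_mul, one_mul, mul_one, Matrix.diagonal_mul_diagonal]

theorem flipBit_ne_zero_of_zero {ι : Type} [Fintype ι] [DecidableEq ι] (k : ι) :
    flipBit k (0 : ι → Fin 2) ≠ 0 := by
  intro h
  have := congrFun h k
  simp [flipBit_self] at this

/-- `H_else` does not act on the ancillas and so has no off-diagonal block. A flip of the zero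
string is never zero, which makes one of the two projectors redundant. -/
theorem projPlus_V_projMinus :
    (1 - projMinus n M R C) * V T R C J * projMinus n M R C =
      flips T R C J fun w y => if flipBit (Sum.inl w) y = 0 then 1 else 0 := by
  rw [one_sub_projMinus_eq, projMinus_eq, ancDiag_mul_V_mul_ancDiag]
  have h1 : (fun y : Anc M R C → Fin 2 =>
      (if y = 0 then (0 : ℂ) else 1) * (if y = 0 then 1 else 0)) = fun _ => 0 := by
    funext y; split_ifs <;> simp
  rw [h1, Matrix.diagonal_zero, Matrix.kronecker_zero, zero_add]
  congr 1
  funext w y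
  by_cases hy : y = 0
  · rw [hy, if_pos rfl, if_neg (flipBit_ne_zero_of_zero _), zero_mul]
  · rw [if_neg hy, one_mul]

theorem projMinus_V_projPlus :
    projMinus n M R C * V T R C J * (1 - projMinus n M R C) =
      flips T R C J fun _ y => if y = 0 then 1 else 0 := by
  rw [one_sub_projMinus_eq, projMinus_eq, ancDiag_mul_V_mul_ancDiag]
  have h1 : (fun y : Anc M R C → Fin 2 =>
      (if y = 0 then (1 : ℂ) else 0) * (if y = 0 then 0 else 1)) = fun _ => 0 := by
    funext y; split_ifs <;> simp
  rw [h1, Matrix.diagonal_zero, Matrix.kronecker_zero, zero_add]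
  congr 1
  funext w y
  by_cases hy : y = 0
  · rw [hy, if_pos rfl, if_neg (flipBit_ne_zero_of_zero _), one_mul]
  · rw [if_neg hy, zero_mul]

theorem projMinus_V_projMinus :
    projMinus n M R C * V T R C J * projMinus n M R C = T.Helse ⊗ₖ zeroProj M R C := by
  rw [projMinus_eq, ancDiag_mul_V_mul_ancDiag, zeroProj_eq]
  have h1 : flips T R C J (fun w (y : Anc M R C → Fin 2) => (if y = 0 then (1 : ℂ) else 0) *
      (if flipBit (Sum.inl w) y = 0 then 1 else 0)) = flips T R C J fun _ _ => 0 := by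
    congr 1
    funext w y
    by_cases hy : y = 0
    · rw [hy, if_neg (flipBit_ne_zero_of_zero _), mul_zero]
    · rw [if_neg hy, zero_mul]
  rw [h1]
  have h2 : (fun y : Anc M R C → Fin 2 =>
      (if y = 0 then (1 : ℂ) else 0) * (if y = 0 then 1 else 0)) =
      fun y => if y = 0 then 1 else 0 := by
    funext y; split_ifs <;> simp
  rw [h2]
  simp [flips, ladder]

/-! ### The number of excited direct ancillas -/

/-- No core ancilla is excited. -/
def CoreZero {M R C : ℕ} (y : Anc M R C → Fin 2) : Prop := ∀ c, y (Sum.inr c) = 0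

/-- The number of excited direct ancillas. -/
def exc {M R C : ℕ} (y : Anc M R C → Fin 2) : ℕ :=
  (Finset.univ.filter fun w : Fin M × Fin R => y (Sum.inl w) ≠ 0).card

variable {R C J}

theorem coreZero_flipBit (w : Fin M × Fin R) (y : Anc M R C → Fin 2) :
    CoreZero (flipBit (Sum.inl w) y) ↔ CoreZero y :=
  forall_congr' fun c => by rw [flipBit_of_ne Sum.inr_ne_inl]

theorem exc_flipBit_add_one {w : Fin M × Fin R} {y : Anc M R C → Fin 2}
    (h : y (Sum.inl w) ≠ 0) : exc (flipBit (Sum.inl w) y) + 1 = exc y := by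
  have h1 : (Finset.univ.filter fun w' => flipBit (Sum.inl w) y (Sum.inl w') ≠ 0) =
      (Finset.univ.filter fun w' => y (Sum.inl w') ≠ 0).erase w := by
    ext w'
    by_cases hw : w' = w
    · subst hw
      have : ∀ b : Fin 2, b ≠ 0 → 1 + b = 0 := by decide
      simp [flipBit_self, this _ h]
    · simp [hw, flipBit_of_ne (k := Sum.inl w) (i := Sum.inl w') (by simpa using hw)]
  rw [exc, exc, h1, Finset.card_erase_add_one (by simpa using h)]

theorem one_le_exc {y : Anc M R C → Fin 2} (hc : CoreZero y) (hy : y ≠ 0) : 1 ≤ exc y := by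
  rw [exc, Nat.one_le_iff_ne_zero, Finset.card_ne_zero]
  by_contra hne
  apply hy
  funext i
  rcases i with w | c
  · by_contra hw
    exact hne ⟨w, by simpa using hw⟩
  · exact hc c

/-- With the core at zero, each excited direct ancilla violates its `C` bonds to the core and
nothing else costs energy. This linear growth compensates the number of available flips. -/
theorem energy_of_coreZero {y : Anc M R C → Fin 2} (hc : CoreZero y) :
    energy M R C J y = exc y * (J * C) := by
  have hz : zval 0 = 1 := by simp [zval]
  have h1 : ∀ w : Fin M × Fin R, (C : ℝ) * (1 - zval (y (Sum.inl w))) =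
      if y (Sum.inl w) ≠ 0 then (C * 2 : ℝ) else 0 := by
    intro w
    by_cases h : y (Sum.inl w) = 0
    · simp [h, hz]
    · simp only [h, zval, ne_eq, not_false_eq_true, if_true, if_false]; ring
  have h2 : ∑ j : Fin M, ∑ i : Fin R, (C : ℝ) * (1 - zval (y (Sum.inl (j, i)))) =
      exc y * (C * 2) := by
    rw [← Fintype.sum_prod_type' (f := fun j i => (C : ℝ) * (1 - zval (y (Sum.inl (j, i)))))]
    simp only [Prod.mk.eta, h1, ← Finset.sum_filter, Finset.sum_const, nsmul_eq_mul, exc]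
  simp only [energy, hc _, hz, mul_one, sub_self, Finset.sum_const_zero, mul_zero, add_zero,
    Finset.sum_const, Finset.card_univ, Fintype.card_fin, nsmul_eq_mul]
  rw [h2]; ring

variable {z : ℂ}

theorem norm_green_le (hJ : 0 ≤ J) (hz : ‖z‖ < J * C) (y : Anc M R C → Fin 2) :
    ‖green M R C J z y‖ ≤ (J * C - ‖z‖)⁻¹ := by
  rw [green]
  split_ifs with h
  · simpa using hz.le
  · rw [norm_inv]
    have h1 := energy_ge M R C J hJ y h
    have h2 := energy_sub_norm_le (J := J) (z := z) y
    exact inv_anti₀ (by linarith) (by linarith)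

/-- For `k ≥ 1` one has `k Δ - ‖z‖ ≥ k (Δ - ‖z‖)`. -/
theorem norm_green_le_of_coreZero (hz : ‖z‖ < J * C) {y : Anc M R C → Fin 2}
    (hc : CoreZero y) (hy : y ≠ 0) :
    ‖green M R C J z y‖ ≤ (exc y * (J * C - ‖z‖))⁻¹ := by
  have h2 := energy_sub_norm_le (J := J) (z := z) y
  have h3 : (1 : ℝ) ≤ exc y := by exact_mod_cast one_le_exc hc hy
  rw [energy_of_coreZero hc] at h2
  rw [green, if_neg hy, norm_inv]
  refine inv_anti₀ (mul_pos (by linarith) (by linarith)) ?_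
  rw [energy_of_coreZero hc]
  nlinarith [norm_nonneg z]

theorem sum_norm_sq_le_of_support {y : Anc M R C → Fin 2} {F : Fin M × Fin R → ℂ} {a : ℝ}
    (h : ∀ w, F w ≠ 0 → y (Sum.inl w) ≠ 0) (ha : ∀ w, F w ≠ 0 → ‖F w‖ ≤ a) :
    ∑ w, ‖F w‖ ^ 2 ≤ exc y * a ^ 2 := by
  rw [← Finset.sum_filter_add_sum_filter_not Finset.univ
    (fun w : Fin M × Fin R => y (Sum.inl w) ≠ 0)]
  have h1 : ∑ w ∈ Finset.univ.filter (fun w => ¬ y (Sum.inl w) ≠ 0), ‖F w‖ ^ 2 = 0 := by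
    refine Finset.sum_eq_zero fun w hw => ?_
    by_contra hne
    exact (Finset.mem_filter.1 hw).2 (h w fun h0 => hne (by simp [h0]))
  rw [h1, add_zero, exc, ← nsmul_eq_mul]
  refine Finset.sum_le_card_nsmul _ _ _ fun w _ => ?_
  by_cases h0 : F w = 0
  · rw [h0]; simp [sq_nonneg]
  · exact pow_le_pow_left₀ (norm_nonneg _) (ha w h0) 2

end Coupling

/-! ### Norm bounds for the gadget -/

section Bounds

variable {n M : ℕ} (T : Target n M) {R C : ℕ} {J : ℝ} {z : ℂ}

theorem beta_nonneg (j : Fin M) : 0 ≤ beta T R C J j := Real.sqrt_nonneg _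

theorem beta_sq (hJ : 0 ≤ J) (j : Fin M) :
    beta T R C J j ^ 2 = |T.γ j| * (J * C) / (2 * R) :=
  Real.sq_sqrt (by positivity)

theorem abs_sign_le_one (x : ℝ) : |Real.sign x| ≤ 1 := by
  rcases Real.sign_apply_eq x with h | h | h <;> rw [h] <;> simp

theorem norm_coupling_le (w : Fin M × Fin R) :
    ‖coupling T R C J w‖ ≤ 2 * beta T R C J w.1 := by
  rw [coupling, norm_smul, Complex.norm_real, Real.norm_of_nonneg (beta_nonneg T _), mul_comm]
  refine mul_le_mul_of_nonneg_right ?_ (beta_nonneg T _)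
  refine (norm_sub_le _ _).trans ?_
  rw [norm_smul, Complex.norm_real, Real.norm_eq_abs]
  have h1 : ‖T.opA w.1‖ ≤ 1 := norm_site_le _ _
  have h2 : ‖T.opB w.1‖ ≤ 1 := norm_site_le _ _
  nlinarith [abs_sign_le_one (T.γ w.1), abs_nonneg (Real.sign (T.γ w.1)),
    norm_nonneg (T.opB w.1)]

/-- The `R` copies cancel the `1 / R` in `β²`, so no norm estimate depends on `R`. -/
theorem sum_coupling_bound (hJ : 0 ≤ J) (hR : 0 < R) :
    ∑ w : Fin M × Fin R, (2 * beta T R C J w.1) ^ 2 = 2 * (J * C) * ∑ j, |T.γ j| := by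
  have hR' : (R : ℝ) ≠ 0 := by exact_mod_cast hR.ne'
  rw [Fintype.sum_prod_type, Finset.mul_sum]
  refine Finset.sum_congr rfl fun j _ => ?_
  simp only [Finset.sum_const, Finset.card_univ, Fintype.card_fin, nsmul_eq_mul, mul_pow,
    beta_sq T hJ]
  field_simp

theorem norm_flips_le (hJ : 0 ≤ J) (hR : 0 < R)
    (f : Fin M × Fin R → (Anc M R C → Fin 2) → ℂ) {t : ℝ} (ht : 0 ≤ t)
    (hf : (∀ y, ∑ w, ‖f w y‖ ^ 2 ≤ t) ∨ ∀ y, ∑ w, ‖f w (flipBit (Sum.inl w) y)‖ ^ 2 ≤ t) :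
    ‖flips T R C J f‖ ≤ √t * √(2 * (J * C) * ∑ j, |T.γ j|) := by
  rw [← Real.sqrt_mul ht, ← sum_coupling_bound T hJ hR]
  refine Real.le_sqrt_of_sq_le ?_
  rcases hf with hf | hf
  · exact norm_ladder_sq_le (norm_coupling_le T) ht hf
  · exact norm_ladder_sq_le' (norm_coupling_le T) ht hf

theorem sum_ite_eq_zero_le_one (y : Anc M R C → Fin 2) :
    ∑ w : Fin M × Fin R, ‖(if flipBit (Sum.inl w) y = 0 then 1 else 0 : ℂ)‖ ^ 2 ≤ 1 := by
  by_cases h : ∃ w : Fin M × Fin R, flipBit (Sum.inl w) y = 0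
  · obtain ⟨w, hw⟩ := h
    rw [Finset.sum_eq_single w]
    · rw [if_pos hw]; simp
    · intro w' _ hne
      rw [if_neg]
      · simp
      · intro hw'
        have hy : y = flipBit (Sum.inl w) 0 := by rw [← hw, flipBit_flipBit]
        have h1 := congrFun hw' (Sum.inl w')
        rw [flipBit_self, hy, flipBit_of_ne (by simpa using hne)] at h1
        simp at h1
    · simp
  · push Not at h
    simp [h]

theorem norm_projPlus_V_projMinus_le (hJ : 0 ≤ J) (hR : 0 < R) :
    ‖(1 - projMinus n M R C) * V T R C J * projMinus n M R C‖ ≤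
      √(2 * (J * C) * ∑ j, |T.γ j|) := by
  rw [projPlus_V_projMinus]
  refine (norm_flips_le T hJ hR _ zero_le_one (Or.inl fun y => ?_)).trans (by simp)
  exact sum_ite_eq_zero_le_one y

theorem norm_projMinus_V_projPlus_le (hJ : 0 ≤ J) (hR : 0 < R) :
    ‖projMinus n M R C * V T R C J * (1 - projMinus n M R C)‖ ≤
      √(2 * (J * C) * ∑ j, |T.γ j|) := by
  rw [projMinus_V_projPlus]
  refine (norm_flips_le T hJ hR _ zero_le_one (Or.inr fun y => ?_)).trans (by simp)
  exact sum_ite_eq_zero_le_one y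

/-! ### Restriction to the sector without core excitations -/

open Classical in
/-- The projector onto the strings without core excitations. -/
def coreProj (n M R C : ℕ) : SysOp n M R C := ancDiag n fun y => if CoreZero y then 1 else 0

/-- One step `G_+ V_+` of the self-energy expansion, restricted to the sector without core
excitations. -/
def coreStep (T : Target n M) (R C : ℕ) (J : ℝ) (z : ℂ) : SysOp n M R C :=
  coreProj n M R C * (resolventPlus (1 - projMinus n M R C) (H n M R C J) z *
    ((1 - projMinus n M R C) * V T R C J * (1 - projMinus n M R C)))

open Classical in
theorem commute_coreProj_flips (k : Fin M × Fin R → (Anc M R C → Fin 2) → ℂ) :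
    Commute (coreProj n M R C) (flips T R C J k) := by
  have h1 := ancDiag_mul_flips_mul_ancDiag (n := n) T R C J
    (fun y => if CoreZero y then 1 else 0) (fun _ => 1) k
  have h2 := ancDiag_mul_flips_mul_ancDiag (n := n) T R C J (fun _ => 1)
    (fun y => if CoreZero y then 1 else 0) k
  rw [ancDiag_one, mul_one] at h1
  rw [ancDiag_one, one_mul] at h2
  rw [Commute, SemiconjBy, coreProj, h1, h2]
  congr 1
  funext w y
  simp only [coreZero_flipBit, mul_one, one_mul, mul_comm]

theorem commute_ancDiag (f g : (Anc M R C → Fin 2) → ℂ) :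
    Commute (ancDiag n f) (ancDiag n g) := by
  rw [Commute, SemiconjBy, ancDiag_mul, ancDiag_mul]
  simp only [mul_comm]

theorem commute_coreProj_V : Commute (coreProj n M R C) (V T R C J) := by
  rw [V_eq]
  refine Commute.add_right ?_ (commute_coreProj_flips T _)
  rw [Commute, SemiconjBy, coreProj, ancDiag]
  simp only [← Matrix.mul_kronecker_mul, one_mul, mul_one, Matrix.diagonal_mul_diagonal]

theorem commute_coreProj_projPlus : Commute (coreProj n M R C) (1 - projMinus n M R C) := by
  rw [one_sub_projMinus_eq, coreProj]
  exact commute_ancDiag _ _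

theorem coreProj_mul_projMinus :
    coreProj n M R C * projMinus n M R C = projMinus n M R C := by
  rw [projMinus_eq, coreProj, ancDiag_mul]
  congr 1
  funext y
  by_cases h : y = 0
  · rw [if_pos h, if_pos, mul_one]
    intro c; rw [h]; rfl
  · rw [if_neg h, mul_zero]

theorem pow_mul_eq_of_commute {A : Type*} [Monoid A] {S X x : A} (h : Commute S X)
    (hx : S * x = x) (k : ℕ) : X ^ k * x = (S * X) ^ k * x := by
  have hS : ∀ k : ℕ, S ^ k * x = x := by
    intro k
    induction k with
    | zero => simp
    | succ k ih => rw [pow_succ, mul_assoc, hx, ih]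
  rw [h.mul_pow, (h.pow_pow k k).eq, mul_assoc, hS]

/-- Every factor preserves the core configuration, and the rightmost one starts from the zero
string, so the sector projector can be inserted at each step. -/
theorem liftTerm_eq (hJ : 0 ≤ J) (hz : ‖z‖ < J * C) (k : ℕ) :
    liftTerm (projMinus n M R C) (H n M R C J) (V T R C J) z k =
      coreStep T R C J z ^ k * (ancDiag n (green M R C J z) *
        ((1 - projMinus n M R C) * V T R C J * projMinus n M R C)) := by
  have hG : Commute (coreProj n M R C) (ancDiag n (green M R C J z)) := commute_ancDiag _ _
  have hQ := commute_coreProj_projPlus (n := n) (M := M) (R := R) (C := C)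
  have hV := commute_coreProj_V T (R := R) (C := C) (J := J)
  rw [liftTerm, coreStep, resolventPlus_eq hJ hz]
  refine pow_mul_eq_of_commute (hG.mul_right ((hQ.mul_right hV).mul_right hQ)) ?_ k
  rw [← mul_assoc (ancDiag n _), ← mul_assoc (coreProj n M R C),
    (hG.mul_right (hQ.mul_right hV)).eq, mul_assoc _ (coreProj n M R C), coreProj_mul_projMinus]

open Classical in
/-- The weights of the bit flips in `coreStep`. -/
def stepWeight (M R C : ℕ) (J : ℝ) (z : ℂ) (w : Fin M × Fin R) (y : Anc M R C → Fin 2) : ℂ :=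
  if CoreZero y ∧ y ≠ 0 ∧ flipBit (Sum.inl w) y ≠ 0 then green M R C J z y else 0

-- The row index is the string after the flip. Hence `y w ≠ 0` marks flips that create an excitation
-- and `y w = 0` those that remove one; the two parts are bounded by rows and by columns
-- respectively.
open Classical in
theorem coreStep_eq (hJ : 0 ≤ J) (hz : ‖z‖ < J * C) :
    coreStep T R C J z =
      T.Helse ⊗ₖ Matrix.diagonal (fun y => if CoreZero y then green M R C J z y else 0) +
      (flips T R C J (fun w y => if y (Sum.inl w) ≠ 0 then stepWeight M R C J z w y else 0) +
        flips T R C J (fun w y => if y (Sum.inl w) = 0 then stepWeight M R C J z w y else 0)) := by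
  rw [coreStep, resolventPlus_eq hJ hz, one_sub_projMinus_eq, coreProj, ← mul_assoc, ancDiag_mul,
    ← mul_assoc, ← mul_assoc, ancDiag_mul, ancDiag_mul_V_mul_ancDiag, flips, flips, flips,
    ← ladder_add]
  congr 2
  · congr 1
    funext y
    by_cases h1 : y = 0
    · simp [h1, green]
    · simp [h1]
  · funext w y
    by_cases h1 : y = 0
    · simp [h1, stepWeight]
    · by_cases h2 : flipBit (Sum.inl w) y = 0
      · simp [h2, stepWeight]
      · by_cases h3 : CoreZero y
        · by_cases h4 : y (Sum.inl w) = 0 <;> simp [h1, h2, h3, h4, stepWeight]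
        · simp [h3, stepWeight]

/-- A string with `k` excitations arises by creation in at most `k` ways, each of weight at most `1
/ (k D)` with `D = Δ - ‖z‖`, in total `1 / (k D²)`. The string before the flip is nonzero, so `k ≥
2`. -/
theorem sum_stepWeight_up_le (hz : ‖z‖ < J * C) (y : Anc M R C → Fin 2) :
    ∑ w, ‖(if y (Sum.inl w) ≠ 0 then stepWeight M R C J z w y else 0)‖ ^ 2 ≤
      (J * C - ‖z‖)⁻¹ ^ 2 / 2 := by
  have hD : 0 < J * C - ‖z‖ := by linarith
  have key : ∀ w : Fin M × Fin R,
      (if y (Sum.inl w) ≠ 0 then stepWeight M R C J z w y else 0) ≠ 0 →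
      y (Sum.inl w) ≠ 0 ∧ CoreZero y ∧ y ≠ 0 ∧ flipBit (Sum.inl w) y ≠ 0 := by
    intro w hw
    by_cases h1 : y (Sum.inl w) = 0
    · simp [h1] at hw
    · rw [if_pos h1, stepWeight] at hw
      by_contra hne
      exact hw (if_neg fun h => hne ⟨h1, h⟩)
  by_cases h2 : 2 ≤ exc y
  · refine (sum_norm_sq_le_of_support (a := (exc y * (J * C - ‖z‖))⁻¹)
      (fun w hw => (key w hw).1) fun w hw => ?_).trans ?_
    · obtain ⟨h1, h3⟩ := key w hw
      rw [if_pos h1, stepWeight, if_pos h3]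
      exact norm_green_le_of_coreZero hz h3.1 h3.2.1
    · have h3 : (2 : ℝ) ≤ exc y := by exact_mod_cast h2
      rw [mul_inv, mul_pow, ← mul_assoc, div_eq_inv_mul]
      refine mul_le_mul_of_nonneg_right ?_ (by positivity)
      rw [sq, ← mul_assoc, mul_inv_cancel₀ (by positivity), one_mul]
      exact inv_anti₀ (by norm_num) h3
  · refine (sum_norm_sq_le_of_support (y := y) (a := 0)
      (fun w hw => (key w hw).1) fun w hw => ?_).trans ?_
    · obtain ⟨h1, h3, h4, h5⟩ := key w hw
      have h6 := one_le_exc ((coreZero_flipBit w y).2 h3) h5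
      have h7 := exc_flipBit_add_one h1
      omega
    · rw [zero_pow two_ne_zero, mul_zero]; positivity

/-- Columns are used because a string can lose an excitation in only `k` ways, whereas it may be
reached by removal from almost `M R` strings. The weight is at most `k / ((k - 1)² D²)`, and `k = 1`
is excluded because the flip would land in the ground space. -/
theorem sum_stepWeight_down_le (hz : ‖z‖ < J * C) (y : Anc M R C → Fin 2) :
    ∑ w, ‖(if flipBit (Sum.inl w) y (Sum.inl w) = 0 then
      stepWeight M R C J z w (flipBit (Sum.inl w) y) else 0)‖ ^ 2 ≤
      2 * (J * C - ‖z‖)⁻¹ ^ 2 := by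
  have hD : 0 < J * C - ‖z‖ := by linarith
  have key : ∀ w : Fin M × Fin R, (if flipBit (Sum.inl w) y (Sum.inl w) = 0 then
      stepWeight M R C J z w (flipBit (Sum.inl w) y) else 0) ≠ 0 →
      flipBit (Sum.inl w) y (Sum.inl w) = 0 ∧ (CoreZero (flipBit (Sum.inl w) y) ∧
        flipBit (Sum.inl w) y ≠ 0 ∧ flipBit (Sum.inl w) (flipBit (Sum.inl w) y) ≠ 0) := by
    intro w hw
    by_cases h1 : flipBit (Sum.inl w) y (Sum.inl w) = 0
    · rw [if_pos h1, stepWeight] at hw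
      by_contra hne
      exact hw (if_neg fun h => hne ⟨h1, h⟩)
    · simp [h1] at hw
  have key2 : ∀ w : Fin M × Fin R, flipBit (Sum.inl w) y (Sum.inl w) = 0 → y (Sum.inl w) ≠ 0 := by
    intro w h1 h2
    rw [flipBit_self, h2] at h1
    simp at h1
  by_cases h2 : 2 ≤ exc y
  · have h3 : (2 : ℝ) ≤ exc y := by exact_mod_cast h2
    have h4 : (0 : ℝ) < exc y - 1 := by linarith
    refine (sum_norm_sq_le_of_support (y := y) (a := ((exc y - 1) * (J * C - ‖z‖))⁻¹)
      (fun w hw => key2 w (key w hw).1) fun w hw => ?_).trans ?_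
    · obtain ⟨h1, h3⟩ := key w hw
      rw [if_pos h1, stepWeight, if_pos h3]
      refine (norm_green_le_of_coreZero hz h3.1 h3.2.1).trans_eq ?_
      rw [← exc_flipBit_add_one (key2 w h1)]
      push_cast
      rw [add_sub_cancel_right]
    · rw [mul_inv, mul_pow, ← mul_assoc]
      refine mul_le_mul_of_nonneg_right ?_ (by positivity)
      rw [inv_pow, ← div_eq_mul_inv, div_le_iff₀ (by positivity)]
      -- This is `k ≤ 2 (k - 1)²` for `k ≥ 2`, with equality at `k = 2`.
      nlinarith
  · refine (sum_norm_sq_le_of_support (y := y) (a := 0)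
      (fun w hw => key2 w (key w hw).1) fun w hw => ?_).trans ?_
    · obtain ⟨h1, h3, h4, h5⟩ := key w hw
      have h6 := one_le_exc h3 h4
      have h7 := exc_flipBit_add_one (key2 w h1)
      omega
    · rw [zero_pow two_ne_zero, mul_zero]; positivity

theorem norm_coreStep_le (hJ : 0 ≤ J) (hR : 0 < R) (hz : ‖z‖ < J * C) :
    ‖coreStep T R C J z‖ ≤
      (‖T.Helse‖ + 2.125 * √(2 * (J * C) * ∑ j, |T.γ j|)) * (J * C - ‖z‖)⁻¹ := by
  classical
  have hD : 0 < J * C - ‖z‖ := by linarith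
  set D := (J * C - ‖z‖)⁻¹ with hDdef
  have hD0 : 0 < D := inv_pos.2 hD
  set E := √(2 * (J * C) * ∑ j, |T.γ j|) with hE
  rw [coreStep_eq T hJ hz]
  have h1 : ‖T.Helse ⊗ₖ Matrix.diagonal
      (fun y : Anc M R C → Fin 2 => if CoreZero y then green M R C J z y else 0)‖ ≤
      ‖T.Helse‖ * D := by
    refine norm_kronecker_diagonal_le _ _ hD0.le fun y => ?_
    split_ifs
    · exact norm_green_le hJ hz y
    · simpa using hD0.le
  have h2 := norm_flips_le T hJ hR (C := C)
    (fun w y => if y (Sum.inl w) ≠ 0 then stepWeight M R C J z w y else 0)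
    (t := D ^ 2 / 2) (by positivity) (Or.inl fun y => sum_stepWeight_up_le hz y)
  have h3 := norm_flips_le T hJ hR (C := C)
    (fun w y => if y (Sum.inl w) = 0 then stepWeight M R C J z w y else 0)
    (t := 2 * D ^ 2) (by positivity) (Or.inr fun y => sum_stepWeight_down_le hz y)
  -- Rational upper bounds for `1 / √2` and `√2`; their sum is the constant `2.125`.
  have h4 : √(D ^ 2 / 2) ≤ 0.71 * D := by
    refine Real.sqrt_le_iff.2 ⟨by positivity, ?_⟩
    nlinarith [sq_nonneg D]
  have h5 : √(2 * D ^ 2) ≤ 1.415 * D := by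
    refine Real.sqrt_le_iff.2 ⟨by positivity, ?_⟩
    nlinarith [sq_nonneg D]
  have hE0 : 0 ≤ E := Real.sqrt_nonneg _
  calc _ ≤ ‖T.Helse‖ * D + (√(D ^ 2 / 2) * E + √(2 * D ^ 2) * E) :=
        (norm_add_le _ _).trans (add_le_add h1 ((norm_add_le _ _).trans (add_le_add h2 h3)))
    _ ≤ ‖T.Helse‖ * D + (0.71 * D * E + 1.415 * D * E) := by gcongr
    _ = _ := by ring

theorem norm_liftTerm_le (hJ : 0 ≤ J) (hR : 0 < R) (hz : ‖z‖ < J * C) {q : ℝ}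
    (hq : ‖coreStep T R C J z‖ ≤ q) (k : ℕ) :
    ‖liftTerm (projMinus n M R C) (H n M R C J) (V T R C J) z k‖ ≤
      q ^ k * ((J * C - ‖z‖)⁻¹ * √(2 * (J * C) * ∑ j, |T.γ j|)) := by
  have hD : 0 < J * C - ‖z‖ := by linarith
  have hq0 : 0 ≤ q := (norm_nonneg _).trans hq
  have h1 : ‖(ancDiag n (green M R C J z) *
      ((1 - projMinus n M R C) * V T R C J * projMinus n M R C))‖ ≤
      (J * C - ‖z‖)⁻¹ * √(2 * (J * C) * ∑ j, |T.γ j|) :=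
    (norm_mul_le _ _).trans (mul_le_mul
      (norm_one_kronecker_diagonal_le _ (by positivity) (norm_green_le hJ hz))
      (norm_projPlus_V_projMinus_le T hJ hR) (norm_nonneg _) (by positivity))
  have h3 : 0 ≤ (J * C - ‖z‖)⁻¹ * √(2 * (J * C) * ∑ j, |T.γ j|) := by positivity
  rw [liftTerm_eq T hJ hz]
  induction k with
  | zero => simpa using h1
  | succ k ih =>
    rw [pow_succ', mul_assoc, pow_succ' q, mul_assoc q]
    exact (norm_mul_le _ _).trans (mul_le_mul hq ih (norm_nonneg _) hq0)

theorem norm_term_le (hJ : 0 ≤ J) (hR : 0 < R) (hz : ‖z‖ < J * C) {q : ℝ}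
    (hq : ‖coreStep T R C J z‖ ≤ q) (k : ℕ) :
    ‖term T R C J z (k + 2)‖ ≤
      q ^ k * ((J * C - ‖z‖)⁻¹ * (2 * (J * C) * ∑ j, |T.γ j|)) := by
  have hq0 : 0 ≤ q := (norm_nonneg _).trans hq
  rw [term, selfEnergyTerm_add_two]
  refine (norm_mul_le _ _).trans ((mul_le_mul (norm_projMinus_V_projPlus_le T hJ hR)
    (norm_liftTerm_le T hJ hR hz hq k) (norm_nonneg _) (Real.sqrt_nonneg _)).trans_eq ?_)
  have h0 : 0 ≤ 2 * (J * C) * ∑ j, |T.γ j| := by positivity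
  rw [mul_left_comm, mul_left_comm (√_), Real.mul_self_sqrt h0]

end Bounds

/-! ### The second-order term -/

section SecondOrder

variable {n M : ℕ} (T : Target n M) {R C : ℕ} {J : ℝ} {z : ℂ}

theorem flipBit_zero (w : Fin M × Fin R) :
    flipBit (Sum.inl w) (0 : Anc M R C → Fin 2) = Pi.single (Sum.inl w) 1 := by
  simp [flipBit, Pi.single]

/-- Only singly flipped strings are reached from the ground space, and all of them have energy
exactly `Δ`, so the resolvent acts as a scalar. -/
theorem green_mul_projPlus_V_projMinus :
    ancDiag n (green M R C J z) * ((1 - projMinus n M R C) * V T R C J * projMinus n M R C) =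
      (z - (J * C : ℝ))⁻¹ • ((1 - projMinus n M R C) * V T R C J * projMinus n M R C) := by
  rw [projPlus_V_projMinus]
  have h1 := ancDiag_mul_flips_mul_ancDiag (n := n) T R C J (green M R C J z) (fun _ => 1)
    (fun w y => if flipBit (Sum.inl w) y = 0 then 1 else 0)
  have h2 := ancDiag_mul_flips_mul_ancDiag (n := n) T R C J (fun _ => (z - (J * C : ℝ))⁻¹)
    (fun _ => 1) (fun w y => if flipBit (Sum.inl w) y = 0 then 1 else 0)
  have h3 : ancDiag n (fun _ : Anc M R C → Fin 2 => (z - (J * C : ℝ))⁻¹) =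
      (z - (J * C : ℝ))⁻¹ • 1 := by
    rw [← ancDiag_one, ancDiag_smul]; simp
  rw [ancDiag_one, mul_one] at h1 h2
  rw [h3, smul_mul_assoc, one_mul] at h2
  rw [h1, h2]
  congr 1
  funext w y
  by_cases h : flipBit (Sum.inl w) y = 0
  · have hy : y = Pi.single (Sum.inl w) 1 := by
      rw [← flipBit_zero, ← h, flipBit_flipBit]
    have hy0 : y ≠ 0 := by
      rw [hy]; simp
    rw [if_pos h, green, if_neg hy0, hy, energy_single]
  · rw [if_neg h]; simp

theorem projMinus_V_projPlus_V_projMinus :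
    projMinus n M R C * V T R C J * (1 - projMinus n M R C) *
      ((1 - projMinus n M R C) * V T R C J * projMinus n M R C) =
      (∑ w, coupling T R C J w * coupling T R C J w) ⊗ₖ zeroProj M R C := by
  rw [projMinus_V_projPlus, projPlus_V_projMinus, flips, flips, ladder, ladder,
    Finset.sum_mul_sum]
  have h : ∀ w w' : Fin M × Fin R,
      (Matrix.diagonal (fun y : Anc M R C → Fin 2 => if y = 0 then (1 : ℂ) else 0) *
        site Pauli.X (Sum.inl w)) * (Matrix.diagonal (fun y : Anc M R C → Fin 2 =>
          if flipBit (Sum.inl w') y = 0 then (1 : ℂ) else 0) * site Pauli.X (Sum.inl w')) =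
      if w = w' then zeroProj M R C else 0 := by
    intro w w'
    rw [mul_assoc, ← mul_assoc (site _ _), site_X_mul_diagonal, mul_assoc (Matrix.diagonal _),
      ← mul_assoc (Matrix.diagonal _), Matrix.diagonal_mul_diagonal]
    by_cases hw : w = w'
    · subst hw
      rw [if_pos rfl, site_mul_self, mul_one, zeroProj_eq]
      congr 1
      funext y
      rw [flipBit_flipBit]
      split_ifs <;> simp
    · rw [if_neg hw]
      have h0 : (fun y : Anc M R C → Fin 2 => (if y = 0 then (1 : ℂ) else 0) *
          if flipBit (Sum.inl w') (flipBit (Sum.inl w) y) = 0 then 1 else 0) = fun _ => 0 := by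
        funext y
        by_cases hy : y = 0
        · rw [if_neg (c := flipBit _ _ = 0), mul_zero]
          intro h1
          have h2 := congrFun h1 (Sum.inl w)
          rw [flipBit_of_ne (by simpa using hw), flipBit_self, hy] at h2
          simp at h2
        · rw [if_neg hy, zero_mul]
      rw [h0]; simp
  simp only [← Matrix.mul_kronecker_mul, h]
  have h2 : ∀ w : Fin M × Fin R, ∑ w', (coupling T R C J w * coupling T R C J w') ⊗ₖ
      (if w = w' then zeroProj M R C else 0) =
      (coupling T R C J w * coupling T R C J w) ⊗ₖ zeroProj M R C := by
    intro w
    rw [Finset.sum_eq_single w]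
    · rw [if_pos rfl]
    · intro w' _ hne
      rw [if_neg hne.symm, Matrix.kronecker_zero]
    · simp
  simp only [h2]
  ext x y
  simp only [Matrix.sum_apply, Matrix.kroneckerMap_apply, Finset.sum_mul]

/-- The positive operator `∑ j, |γ j| (1 - sgn (γ j) A ⊗ B)` generated at second order. -/
def secondOrder : Op (Fin n) :=
  ∑ j, (((|T.γ j| : ℝ) : ℂ) • 1 - (T.γ j : ℂ) • (T.opA j * T.opB j))

/-- On distinct qubits `A` and `B` commute, so `(A - s B)² = 1 + s² - 2 s A B`. The value of `β` is
chosen so that `R β² = |γ| Δ / 2`. -/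
theorem sum_coupling_mul_self (hab : ∀ j, T.a j ≠ T.b j) (hJ : 0 ≤ J) (hR : 0 < R) :
    ∑ w, coupling T R C J w * coupling T R C J w = ((J * C : ℝ) : ℂ) • secondOrder T := by
  have hR' : (R : ℝ) ≠ 0 := by exact_mod_cast hR.ne'
  rw [Fintype.sum_prod_type, secondOrder, Finset.smul_sum]
  refine Finset.sum_congr rfl fun j _ => ?_
  have hA : T.opA j * T.opA j = 1 := site_mul_self _ _
  have hB : T.opB j * T.opB j = 1 := site_mul_self _ _
  have hBA : T.opB j * T.opA j = T.opA j * T.opB j := (site_commute _ _ (hab j)).symm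
  have hc : coupling T R C J (j, (⟨0, hR⟩ : Fin R)) * coupling T R C J (j, ⟨0, hR⟩) =
      ((beta T R C J j ^ 2 : ℝ) : ℂ) • (((1 + Real.sign (T.γ j) ^ 2 : ℝ) : ℂ) • 1 -
        ((2 * Real.sign (T.γ j) : ℝ) : ℂ) • (T.opA j * T.opB j)) := by
    simp only [coupling, sub_mul, mul_sub, hA, hB, hBA, smul_mul_assoc,
      mul_smul_comm]
    push_cast
    module
  have hc' : ∀ i : Fin R, coupling T R C J (j, i) * coupling T R C J (j, i) =
      coupling T R C J (j, ⟨0, hR⟩) * coupling T R C J (j, ⟨0, hR⟩) := fun i => rfl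
  simp only [hc', Finset.sum_const, Finset.card_univ, Fintype.card_fin]
  rw [hc, ← Nat.cast_smul_eq_nsmul ℂ, smul_smul, beta_sq T hJ, smul_sub, smul_sub, smul_smul,
    smul_smul, smul_smul, smul_smul]
  -- For `γ j = 0` the sign is `0` rather than `±1`, but the prefactor vanishes.
  have hs : |T.γ j| * (1 + Real.sign (T.γ j) ^ 2) = 2 * |T.γ j| ∧
      |T.γ j| * Real.sign (T.γ j) = T.γ j := by
    rcases lt_trichotomy (T.γ j) 0 with h | h | h
    · rw [Real.sign_of_neg h, abs_of_neg h]; constructor <;> ring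
    · rw [h]; simp
    · rw [Real.sign_of_pos h, abs_of_pos h]; constructor <;> ring
  have e1 : (R : ℝ) * (|T.γ j| * (J * C) / (2 * R)) * (1 + Real.sign (T.γ j) ^ 2) =
      J * C * |T.γ j| := by
    field_simp
    linear_combination (J * C) * hs.1
  have e2 : (R : ℝ) * (|T.γ j| * (J * C) / (2 * R)) * (2 * Real.sign (T.γ j)) =
      J * C * T.γ j := by
    field_simp
    linear_combination (J * C) * hs.2
  congr 2
  · exact_mod_cast e1
  · exact_mod_cast e2

theorem term_two_eq (hab : ∀ j, T.a j ≠ T.b j) (hJ : 0 ≤ J) (hR : 0 < R) (hz : ‖z‖ < J * C) :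
    term T R C J z 2 =
      ((z - (J * C : ℝ))⁻¹ * (J * C : ℝ)) • (secondOrder T ⊗ₖ zeroProj M R C) := by
  have h := selfEnergyTerm_add_two (projMinus n M R C) (H n M R C J) (V T R C J) z 0
  rw [liftTerm_eq T hJ hz, pow_zero, one_mul, green_mul_projPlus_V_projMinus, mul_smul_comm,
    projMinus_V_projPlus_V_projMinus, sum_coupling_mul_self T hab hJ hR, Matrix.smul_kronecker,
    smul_smul] at h
  exact h

/-- Together, the interaction terms and the energy shift are exactly minus the second-order
operator. -/
theorem Heff_eq : Heff T R C =
    projMinus n M R C * V T R C J * projMinus n M R C - secondOrder T ⊗ₖ zeroProj M R C := by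
  have h : secondOrder T = ((∑ j, |T.γ j| : ℝ) : ℂ) • 1 -
      ∑ j, (T.γ j : ℂ) • (T.opA j * T.opB j) := by
    rw [secondOrder, Finset.sum_sub_distrib, ← Finset.sum_smul]
    push_cast
    rfl
  rw [projMinus_V_projMinus, Heff, Target.Htarg, h, projMinus, Matrix.add_kronecker, sub_eq_add_neg
    (_ • (1 : Op (Fin n))), Matrix.add_kronecker, Matrix.smul_kronecker, ← neg_one_smul ℂ (∑ j, _),
    Matrix.smul_kronecker]
  module

theorem norm_secondOrder_kronecker_le :
    ‖secondOrder T ⊗ₖ zeroProj M R C‖ ≤ 2 * ∑ j, |T.γ j| := by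
  have h1 : ‖secondOrder T‖ ≤ 2 * ∑ j, |T.γ j| := by
    rw [secondOrder, Finset.mul_sum]
    refine norm_sum_le_of_le _ fun j _ => ?_
    refine (norm_sub_le _ _).trans ?_
    have hA : ‖T.opA j‖ ≤ 1 := norm_site_le _ _
    have hB : ‖T.opB j‖ ≤ 1 := norm_site_le _ _
    have hAB : ‖T.opA j * T.opB j‖ ≤ 1 :=
      (norm_mul_le _ _).trans (mul_le_one₀ hA (norm_nonneg _) hB)
    have h1 : ‖(1 : Op (Fin n))‖ ≤ 1 := norm_le_one_of_conjTranspose_mul_self _ (by simp)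
    rw [norm_smul, norm_smul, Complex.norm_real, Complex.norm_real, Real.norm_eq_abs,
      Real.norm_eq_abs, abs_abs]
    nlinarith [abs_nonneg (T.γ j)]
  rw [zeroProj_eq]
  refine (norm_kronecker_diagonal_le _ _ zero_le_one fun y => ?_).trans (by rwa [mul_one])
  split_ifs <;> simp

end SecondOrder

/-! ### Estimates for the parameters -/

section Parameters

/-- Explains the choice `K = κ ^ (-(1 / d))`: a lower bound on `R` becomes a bound by `κ R ^ d`. -/
theorem le_mul_rpow_of_rpow_le {d κ t r : ℝ} (hd : 0 < d) (hκ : 0 < κ) (ht : 0 ≤ t)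
    (h : κ ^ (-(1 / d)) * t ^ (1 / d) ≤ r) : t ≤ κ * r ^ d := by
  have h1 : (κ ^ (-(1 / d)) * t ^ (1 / d)) ^ d ≤ r ^ d :=
    Real.rpow_le_rpow (by positivity) h hd.le
  rw [Real.mul_rpow (by positivity) (by positivity), ← Real.rpow_mul hκ.le, ← Real.rpow_mul ht,
    neg_mul, one_div_mul_cancel hd.ne', Real.rpow_neg_one, Real.rpow_one] at h1
  rwa [inv_mul_le_iff₀ hκ] at h1

/-- The relative strength of the perturbation that makes all error terms small. -/
def smallness (Γ ε₀ : ℝ) : ℝ := (72 * (1 + ε₀ ^ 3 + √(2 * Γ) * ε₀ + Γ * ε₀ ^ 2))⁻¹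

theorem smallness_pos {Γ ε₀ : ℝ} (hΓ : 0 < Γ) (hε₀ : 0 < ε₀) : 0 < smallness Γ ε₀ := by
  unfold smallness; positivity

theorem smallness_mul {Γ ε₀ : ℝ} (hΓ : 0 < Γ) (hε₀ : 0 < ε₀) :
    smallness Γ ε₀ * (1 + ε₀ ^ 3 + √(2 * Γ) * ε₀ + Γ * ε₀ ^ 2) = 1 / 72 := by
  unfold smallness
  have : 0 < 1 + ε₀ ^ 3 + √(2 * Γ) * ε₀ + Γ * ε₀ ^ 2 := by positivity
  field_simp

theorem smallness_le {Γ ε₀ : ℝ} (hΓ : 0 < Γ) (hε₀ : 0 < ε₀) : smallness Γ ε₀ ≤ 1 / 72 := by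
  rw [← smallness_mul hΓ hε₀]
  refine le_mul_of_one_le_right (smallness_pos hΓ hε₀).le ?_
  have : 0 ≤ ε₀ ^ 3 + √(2 * Γ) * ε₀ + Γ * ε₀ ^ 2 := by positivity
  linarith

/-- Hypotheses on the sizes of the gap `Δ`, the couplings (`g` their maximum, `S` their sum) and
the norm `h` of the remaining Hamiltonian. -/
structure Regime (Γ ε₀ ε m g S h Δ : ℝ) : Prop where
  Γ_pos : 0 < Γ
  ε₀_pos : 0 < ε₀
  ε_pos : 0 < ε
  ε_le : ε ≤ ε₀
  m_ge : 1 ≤ m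
  g_pos : 0 < g
  g_le : g ≤ Γ
  S_nonneg : 0 ≤ S
  S_le : S ≤ m * g
  h_nonneg : 0 ≤ h
  gap : m ^ 3 ≤ smallness Γ ε₀ * ε ^ 2 * Δ
  rest : h ^ 2 ≤ smallness Γ ε₀ * (2 * m * g * Δ)

namespace Regime

variable {Γ ε₀ ε m g S h Δ : ℝ} (r : Regime Γ ε₀ ε m g S h Δ)
include r

theorem Δ_pos : 0 < Δ := by
  have h1 := smallness_pos r.Γ_pos r.ε₀_pos
  have h2 : 0 < m ^ 3 := pow_pos (by linarith [r.m_ge]) 3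
  have h3 : 0 < smallness Γ ε₀ * ε ^ 2 := mul_pos h1 (pow_pos r.ε_pos 2)
  exact pos_of_mul_pos_right (h2.trans_le r.gap) h3.le

theorem m_pow_le (k : ℕ) (hk : k ≤ 3) : m ^ k ≤ smallness Γ ε₀ * ε ^ 2 * Δ :=
  (pow_le_pow_right₀ r.m_ge hk).trans r.gap

theorem S_le_mul : S ≤ Γ * m :=
  r.S_le.trans (by nlinarith [r.m_ge, r.g_le])

theorem S_le_gap : S ≤ smallness Γ ε₀ * (Γ * ε ^ 2) * Δ := by
  have h1 := r.m_pow_le 1 (by norm_num)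
  rw [pow_one] at h1
  have h2 := mul_le_mul_of_nonneg_left h1 r.Γ_pos.le
  linarith [r.S_le_mul]

/-- The terms `ε₀ ^ 3`, `√(2 * Γ) * ε₀` and `Γ * ε₀ ^ 2` in `smallness` are designed to absorb `ε`,
`h` and `S` respectively. -/
theorem radius_le : ε + h + S ≤ Δ / 72 := by
  have hκ := smallness_pos r.Γ_pos r.ε₀_pos
  have hΔ := r.Δ_pos
  have hε := r.ε_pos
  have hm := r.m_ge
  have hΓ := r.Γ_pos
  have h1 : ε ≤ smallness Γ ε₀ * ε₀ ^ 3 * Δ := by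
    have h2 := r.m_pow_le 0 (by norm_num)
    rw [pow_zero] at h2
    calc ε = ε * 1 := by ring
      _ ≤ ε * (smallness Γ ε₀ * ε ^ 2 * Δ) := by gcongr
      _ = smallness Γ ε₀ * ε ^ 3 * Δ := by ring
      _ ≤ _ := by gcongr; exact r.ε_le
  have h2 : h ≤ smallness Γ ε₀ * (√(2 * Γ) * ε₀) * Δ := by
    have h3 : h ≤ smallness Γ ε₀ * (√(2 * Γ) * ε) * Δ := by
      refine le_of_sq_le_sq ?_ (by positivity)
      have e : (smallness Γ ε₀ * (√(2 * Γ) * ε) * Δ) ^ 2 =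
          smallness Γ ε₀ * (2 * Γ * Δ) * (smallness Γ ε₀ * ε ^ 2 * Δ) := by
        have := Real.sq_sqrt (show (0 : ℝ) ≤ 2 * Γ by positivity)
        linear_combination (smallness Γ ε₀ * ε * Δ) ^ 2 * this
      rw [e]
      have h4 := r.m_pow_le 1 (by norm_num)
      rw [pow_one] at h4
      have h5 := r.g_le
      have h6 := r.g_pos
      calc h ^ 2 ≤ smallness Γ ε₀ * (2 * m * g * Δ) := r.rest
        _ = smallness Γ ε₀ * (2 * g * Δ) * m := by ring
        _ ≤ smallness Γ ε₀ * (2 * Γ * Δ) * m := by gcongr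
        _ ≤ _ := by gcongr
    refine h3.trans ?_
    gcongr
    exact r.ε_le
  have h3 : S ≤ smallness Γ ε₀ * (Γ * ε₀ ^ 2) * Δ := by
    refine r.S_le_gap.trans ?_
    gcongr
    exact r.ε_le
  have h4 := smallness_mul r.Γ_pos r.ε₀_pos
  nlinarith

/-- The ratio of successive orders of the self-energy expansion. -/
theorem ratio_eq : √(18 * m * g / Δ) = 3 * √(2 * m * g * Δ) / Δ := by
  have hΔ := r.Δ_pos
  have hm := r.m_ge
  have hg := r.g_pos
  have h0 : 0 ≤ 2 * m * g * Δ := by positivity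
  rw [Real.sqrt_eq_iff_mul_self_eq (by positivity) (by positivity)]
  have := Real.mul_self_sqrt h0
  have e : 18 * m * g / Δ = 9 * (2 * m * g * Δ) / (Δ * Δ) := by field_simp; norm_num
  rw [e, ← this]
  field_simp
  norm_num

theorem ratio_sq : Δ * √(18 * m * g / Δ) ^ 2 = 18 * m * g := by
  have hΔ := r.Δ_pos
  have hm := r.m_ge
  have hg := r.g_pos
  rw [Real.sq_sqrt (by positivity)]
  field_simp

theorem h_le : h ≤ √(2 * m * g * Δ) / 8 := by
  have hm := r.m_ge
  have hg := r.g_pos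
  have hΔ := r.Δ_pos
  have h0 : 0 ≤ 2 * m * g * Δ := by positivity
  refine le_of_sq_le_sq ?_ (by positivity)
  rw [div_pow, Real.sq_sqrt h0]
  -- The bound `1 / 72` on `smallness` suffices here since `72 ≥ 8²`.
  have h1 := mul_le_mul_of_nonneg_right (smallness_le r.Γ_pos r.ε₀_pos) h0
  linarith [r.rest]

theorem ratio_le_half : √(18 * m * g / Δ) ≤ 1 / 2 := by
  have hΔ := r.Δ_pos
  have hκ := smallness_pos r.Γ_pos r.ε₀_pos
  have hε := r.ε_pos
  refine Real.sqrt_le_iff.2 ⟨by norm_num, ?_⟩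
  rw [div_le_iff₀ hΔ]
  have h1 : m * g ≤ smallness Γ ε₀ * (Γ * ε ^ 2) * Δ := by
    have h1 := r.m_pow_le 1 (by norm_num)
    rw [pow_one] at h1
    have h2 := mul_le_mul h1 r.g_le r.g_pos.le (by positivity)
    linarith
  -- The factor `72` is `18 * 4`, which yields `q² ≤ 1 / 4`.
  have h2 : smallness Γ ε₀ * (Γ * ε ^ 2) ≤ 1 / 72 := by
    rw [← smallness_mul r.Γ_pos r.ε₀_pos]
    refine mul_le_mul_of_nonneg_left ?_ hκ.le
    have h3 : Γ * ε ^ 2 ≤ Γ * ε₀ ^ 2 := by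
      have := r.ε_le
      have := r.Γ_pos
      gcongr
    have h4 : 0 ≤ √(2 * Γ) * ε₀ := mul_nonneg (Real.sqrt_nonneg _) r.ε₀_pos.le
    have h5 := pow_pos r.ε₀_pos 3
    linarith
  have h3 := mul_le_mul_of_nonneg_right h2 hΔ.le
  linarith

/-- The square of the left side is `18 g m³ / Δ`; this is where the cubic growth of the gap in `M`
is needed. -/
theorem m_mul_ratio_le : m * √(18 * m * g / Δ) ≤ √(18 * Γ) * ε := by
  have hΔ := r.Δ_pos
  have hm := r.m_ge
  have hg := r.g_pos
  have hε := r.ε_pos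
  have hΓ := r.Γ_pos
  refine le_of_sq_le_sq ?_ (by positivity)
  rw [mul_pow, mul_pow, Real.sq_sqrt (by positivity), Real.sq_sqrt (by positivity),
    ← mul_div_assoc, div_le_iff₀ hΔ]
  have hκ : smallness Γ ε₀ ≤ 1 := (smallness_le r.Γ_pos r.ε₀_pos).trans (by norm_num)
  calc m ^ 2 * (18 * m * g) = 18 * g * m ^ 3 := by ring
    _ ≤ 18 * g * (smallness Γ ε₀ * ε ^ 2 * Δ) := by gcongr; exact r.gap
    _ ≤ 18 * Γ * (1 * ε ^ 2 * Δ) := by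
        have := r.g_le
        have := smallness_pos r.Γ_pos r.ε₀_pos
        gcongr
    _ = _ := by ring

variable {x : ℝ} (hx : x ≤ ε + h + S)
include hx

theorem lt_gap : x < Δ := by linarith [r.radius_le, r.Δ_pos]

theorem inv_le : (Δ - x)⁻¹ ≤ 1.02 / Δ := by
  have hΔ := r.Δ_pos
  have h1 := r.radius_le
  rw [inv_le_comm₀ (by linarith) (by positivity), inv_div, div_le_iff₀ (by norm_num)]
  linarith

theorem step_le :
    (h + 2.125 * √(2 * Δ * S)) * (Δ - x)⁻¹ ≤ √(18 * m * g / Δ) := by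
  have hΔ := r.Δ_pos
  have h1 : √(2 * Δ * S) ≤ √(2 * m * g * Δ) := by
    refine Real.sqrt_le_sqrt ?_
    nlinarith [r.S_le]
  have h2 := r.h_le
  have h3 := Real.sqrt_nonneg (2 * m * g * Δ)
  have h4 : 0 ≤ (Δ - x)⁻¹ := inv_nonneg.2 (by linarith [r.lt_gap hx])
  -- Numerically `(0.125 + 2.125) * 1.02 = 2.295`, below the factor `3` in the ratio.
  calc _ ≤ (√(2 * m * g * Δ) / 8 + 2.125 * √(2 * m * g * Δ)) * (1.02 / Δ) := by
        gcongr
        exact r.inv_le hx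
    _ ≤ 3 * √(2 * m * g * Δ) / Δ := by
        rw [← mul_div_assoc]
        refine div_le_div_of_nonneg_right ?_ hΔ.le
        linarith
    _ = _ := r.ratio_eq.symm

theorem term_le (k : ℕ) :
    √(18 * m * g / Δ) ^ k * ((Δ - x)⁻¹ * (2 * Δ * S)) ≤
      3 * √2 * Δ * √(18 * m * g / Δ) ^ (k + 2) := by
  have hΔ := r.Δ_pos
  have hS := r.S_nonneg
  have h1 : (Δ - x)⁻¹ * (2 * Δ * S) ≤ 18 * m * g := by
    calc (Δ - x)⁻¹ * (2 * Δ * S) ≤ 1.02 / Δ * (2 * Δ * S) := by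
          gcongr
          exact r.inv_le hx
      _ = 2.04 * S := by field_simp; ring
      _ ≤ _ := by linarith [r.S_le]
  have h2 : (1 : ℝ) ≤ √2 := Real.one_le_sqrt.2 (by norm_num)
  have h3 : 0 ≤ 18 * m * g := by have := r.m_ge; have := r.g_pos; positivity
  calc _ ≤ √(18 * m * g / Δ) ^ k * (18 * m * g) := by gcongr
    _ ≤ √(18 * m * g / Δ) ^ k * (3 * √2 * (18 * m * g)) := by
        refine mul_le_mul_of_nonneg_left ?_ (by positivity)
        exact le_mul_of_one_le_left h3 (by linarith)
    _ = √(18 * m * g / Δ) ^ k * (3 * √2 * (Δ * √(18 * m * g / Δ) ^ 2)) := by rw [r.ratio_sq]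
    _ = _ := by ring

-- Since `Δ q² = 18 m g`, the cubic term is `18 g (m q)` up to a constant, and `m q` is of order
-- `ε`. The constant is `81 = 3 * 1.5 * 18`.
omit hx in
theorem third_order_le :
    3 * √2 * Δ * √(18 * m * g / Δ) ^ 3 ≤ 81 * Γ * √(18 * Γ) * ε := by
  have h1 : √2 ≤ 1.5 := Real.sqrt_le_iff.2 (by norm_num)
  have hg := r.g_pos
  have hΓ := r.Γ_pos
  have hε := r.ε_pos
  have h2 := r.m_mul_ratio_le
  have hm := r.m_ge
  calc 3 * √2 * Δ * √(18 * m * g / Δ) ^ 3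
      = 3 * √2 * (Δ * √(18 * m * g / Δ) ^ 2) * √(18 * m * g / Δ) := by ring
    _ = 3 * √2 * (18 * g * (m * √(18 * m * g / Δ))) := by rw [r.ratio_sq]; ring
    _ ≤ 3 * 1.5 * (18 * Γ * (√(18 * Γ) * ε)) := by
        have := r.g_le
        gcongr
    _ = _ := by ring

/-- Of the three parts of `x`, the `ε` part uses `S / Δ ≤ Γ ε²`, the `h` part uses `h / Δ ≤ q` and
`S ≤ Γ m`, and the `S` part uses `m² ≤ κ ε² Δ`. -/
theorem second_order_le :
    x * (Δ - x)⁻¹ * (2 * S) ≤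
      4 * (Γ * ε₀ ^ 2 + Γ * √(18 * Γ) + Γ ^ 2 * ε₀) * ε := by
  have hΔ := r.Δ_pos
  have hS := r.S_nonneg
  have hε := r.ε_pos
  have hΓ := r.Γ_pos
  have hm := r.m_ge
  have hh := r.h_nonneg
  have hκ0 := smallness_pos r.Γ_pos r.ε₀_pos
  have hκ : smallness Γ ε₀ ≤ 1 := (smallness_le r.Γ_pos r.ε₀_pos).trans (by norm_num)
  have h4 : 0 ≤ (Δ - x)⁻¹ := inv_nonneg.2 (by linarith [r.lt_gap hx])
  have hSΔ : S / Δ ≤ Γ * ε ^ 2 := by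
    rw [div_le_iff₀ hΔ]
    refine r.S_le_gap.trans ?_
    calc smallness Γ ε₀ * (Γ * ε ^ 2) * Δ ≤ 1 * (Γ * ε ^ 2) * Δ := by gcongr
      _ = _ := by ring
  have hεε : ε ^ 2 ≤ ε₀ * ε := by nlinarith [r.ε_le]
  have e1 : ε * (S / Δ) ≤ Γ * ε₀ ^ 2 * ε := by
    calc ε * (S / Δ) ≤ ε * (Γ * ε ^ 2) := by gcongr
      _ ≤ ε * (Γ * ε₀ ^ 2) := by gcongr; exact r.ε_le
      _ = _ := by ring
  have e2 : h * (S / Δ) ≤ Γ * √(18 * Γ) * ε := by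
    have h1 : h / Δ ≤ √(18 * m * g / Δ) := by
      rw [r.ratio_eq]
      gcongr
      linarith [r.h_le, Real.sqrt_nonneg (2 * m * g * Δ)]
    calc h * (S / Δ) = S * (h / Δ) := by ring
      _ ≤ Γ * m * √(18 * m * g / Δ) := by
          gcongr
          exact r.S_le_mul
      _ = Γ * (m * √(18 * m * g / Δ)) := by ring
      _ ≤ Γ * (√(18 * Γ) * ε) := mul_le_mul_of_nonneg_left r.m_mul_ratio_le hΓ.le
      _ = _ := by ring
  have e3 : S * (S / Δ) ≤ Γ ^ 2 * ε₀ * ε := by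
    rw [← mul_div_assoc, div_le_iff₀ hΔ]
    have h2 := r.m_pow_le 2 (by norm_num)
    calc S * S ≤ (Γ * m) * (Γ * m) := by
          have := r.S_le_mul
          gcongr
      _ = Γ ^ 2 * m ^ 2 := by ring
      _ ≤ Γ ^ 2 * (smallness Γ ε₀ * ε ^ 2 * Δ) := by gcongr
      _ ≤ Γ ^ 2 * (1 * (ε₀ * ε) * Δ) := by gcongr
      _ = _ := by ring
  calc x * (Δ - x)⁻¹ * (2 * S) ≤ (ε + h + S) * (2 / Δ) * (2 * S) := by
        have := (r.inv_le hx).trans (div_le_div_of_nonneg_right (by norm_num : (1.02 : ℝ) ≤ 2) hΔ.le)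
        gcongr
    _ = 4 * (ε * (S / Δ) + h * (S / Δ) + S * (S / Δ)) := by ring
    _ ≤ _ := by linarith

end Regime

end Parameters

/-! ### The gadget theorem in terms of the parameter regime -/

section Assembly

variable {n M R C : ℕ} (T : Target n M) {J Γ ε₀ ε : ℝ} {z : ℂ}

theorem norm_tsum_term_le {q a : ℝ} (hq0 : 0 ≤ q) (hq : q ≤ 1 / 2) (f : ℕ → SysOp n M R C)
    (hf : ∀ k, ‖f k‖ ≤ q ^ k * a) : ‖∑' k, f k‖ ≤ 2 * a := by
  have h1 : HasSum (fun k : ℕ => q ^ k * a) ((1 - q)⁻¹ * a) :=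
    (hasSum_geometric_of_lt_one hq0 (by linarith)).mul_right a
  have ha : 0 ≤ a := by simpa using (norm_nonneg _).trans (hf 0)
  refine (tsum_of_norm_bounded h1 hf).trans (mul_le_mul_of_nonneg_right ?_ ha)
  rw [inv_le_comm₀ (by linarith) (by norm_num)]
  linarith

theorem gadget_of_regime (hab : ∀ j, T.a j ≠ T.b j) (hJ : 0 ≤ J) (hR : 0 < R)
    (r : Regime Γ ε₀ ε M T.gammaMax (∑ j, |T.γ j|) ‖T.Helse‖ (J * C))
    (hz : ‖z‖ ≤ ε + ‖T.Helse‖ + ∑ j, |T.γ j|) :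
    InvertibleOn (projPlus n M R C) (z • 1 - H n M R C J) ∧
    Summable (fun k : ℕ => ‖term T R C J z (k + 2)‖) ∧
    ‖selfEnergySeries (projMinus n M R C) (H n M R C J) (V T R C J) z - Heff T R C‖ ≤
      (4 * (Γ * ε₀ ^ 2 + Γ * √(18 * Γ) + Γ ^ 2 * ε₀) + 162 * Γ * √(18 * Γ)) * ε ∧
    (∀ k : ℕ, 3 ≤ k → ‖term T R C J z k‖ ≤
      3 * √2 * (J * C) * √(18 * M * T.gammaMax / (J * C)) ^ k) ∧
    (IsUnit (z • 1 - (H n M R C J + V T R C J)) →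
      InvertibleOn (projMinus n M R C) (z • 1 - (H n M R C J + V T R C J))⁻¹ ∧
      selfEnergySeries (projMinus n M R C) (H n M R C J) (V T R C J) z =
        selfEnergy (projMinus n M R C) (H n M R C J) (V T R C J) z) := by
  have hlt : ‖z‖ < J * C := r.lt_gap hz
  set q := √(18 * M * T.gammaMax / (J * C)) with hqdef
  have hq0 : 0 ≤ q := Real.sqrt_nonneg _
  have hq2 : q ≤ 1 / 2 := r.ratio_le_half
  have hstep : ‖coreStep T R C J z‖ ≤ q := (norm_coreStep_le T hJ hR hlt).trans (r.step_le hz)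
  have hterm : ∀ k, ‖term T R C J z (k + 2)‖ ≤ 3 * √2 * (J * C) * q ^ (k + 2) := fun k =>
    (norm_term_le T hJ hR hlt hstep k).trans (r.term_le hz k)
  have hgeo : ∀ a : ℝ, Summable fun k : ℕ => q ^ k * a := fun a =>
    (summable_geometric_of_lt_one hq0 (by linarith)).mul_right a
  have hlift : Summable (liftTerm (projMinus n M R C) (H n M R C J) (V T R C J) z) :=
    Summable.of_norm_bounded (hgeo _) (norm_liftTerm_le T hJ hR hlt hstep)
  have hsum : Summable fun k : ℕ => ‖term T R C J z (k + 2)‖ :=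
    Summable.of_nonneg_of_le (fun _ => norm_nonneg _) (norm_term_le T hJ hR hlt hstep) (hgeo _)
  refine ⟨invertibleOn_projPlus hJ hlt, hsum, ?_, ?_, ?_⟩
  · have hs' : Summable fun k : ℕ => term T R C J z (k + 2) := hsum.of_norm
    have h1 : selfEnergySeries (projMinus n M R C) (H n M R C J) (V T R C J) z - Heff T R C =
        ((z - (J * C : ℝ))⁻¹ * z) • (secondOrder T ⊗ₖ zeroProj M R C) +
          ∑' k, term T R C J z (k + 3) := by
      have hne : z - ((J * C : ℝ) : ℂ) ≠ 0 := by
        intro h0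
        rw [sub_eq_zero.1 h0, Complex.norm_real] at hlt
        exact absurd hlt (not_lt.2 (le_abs_self _))
      -- The deviation of `Δ / (z - Δ)` from its value `-1` at `z = 0` is `z / (z - Δ)`.
      have h2 : (z - ((J * C : ℝ) : ℂ))⁻¹ * z = (z - ((J * C : ℝ) : ℂ))⁻¹ * ((J * C : ℝ) : ℂ) + 1 := by
        rw [← inv_mul_cancel₀ hne]; ring
      have h3 : ∑' k, term T R C J z (k + 2) = term T R C J z 2 + ∑' k, term T R C J z (k + 3) :=
        hs'.tsum_eq_zero_add
      rw [selfEnergySeries, mul_assoc (projMinus n M R C) (H n M R C J), H_mul_projMinus, mul_zero,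
        zero_add, Heff_eq T (J := J)]
      change _ + ∑' k, term T R C J z (k + 2) - _ = _
      rw [h3, term_two_eq T hab hJ hR hlt, h2]
      module
    have h4 : ‖((z - (J * C : ℝ))⁻¹ * z) • (secondOrder T ⊗ₖ zeroProj M R C)‖ ≤
        4 * (Γ * ε₀ ^ 2 + Γ * √(18 * Γ) + Γ ^ 2 * ε₀) * ε := by
      refine le_trans ?_ (r.second_order_le hz)
      rw [norm_smul, norm_mul, norm_inv, mul_comm ‖z - _‖⁻¹]
      have h5 : J * C - ‖z‖ ≤ ‖z - ((J * C : ℝ) : ℂ)‖ := by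
        have h := norm_sub_norm_le ((J * C : ℝ) : ℂ) z
        rw [norm_sub_rev, Complex.norm_real] at h
        exact (sub_le_sub_right (le_abs_self _) _).trans h
      have h6 := inv_anti₀ (by linarith) h5
      have h7 : 0 ≤ (J * C - ‖z‖)⁻¹ := inv_nonneg.2 (by linarith)
      exact mul_le_mul (mul_le_mul_of_nonneg_left h6 (norm_nonneg _))
        (norm_secondOrder_kronecker_le T) (norm_nonneg _) (mul_nonneg (norm_nonneg _) h7)
    -- The factor `2` is the geometric sum for `q ≤ 1 / 2`; with `81` it gives `162`.
    have h5 : ‖∑' k, term T R C J z (k + 3)‖ ≤ 2 * (81 * Γ * √(18 * Γ) * ε) := by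
      refine norm_tsum_term_le hq0 hq2 _ fun k => ?_
      calc ‖term T R C J z (k + 3)‖ ≤ 3 * √2 * (J * C) * q ^ (k + 1 + 2) := hterm (k + 1)
        _ = q ^ k * (3 * √2 * (J * C) * q ^ 3) := by ring
        _ ≤ _ := mul_le_mul_of_nonneg_left r.third_order_le (pow_nonneg hq0 k)
    rw [h1]
    refine (norm_add_le _ _).trans ((add_le_add h4 h5).trans_eq (by ring))
  · intro k hk
    obtain ⟨k, rfl⟩ := Nat.exists_eq_add_of_le' (show 2 ≤ k by omega)
    exact hterm k
  · exact selfEnergySeries_eq_selfEnergy projMinus_mul_self (projMinus_mul_H J)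
      (H_mul_projMinus J) (invertibleOn_projPlus hJ hlt) hlift

end Assembly

end WeakGadget

end

/-! ### Choice of constants and derivation of the regime -/

theorem claim2 (d : ℝ) (hd0 : 0 < d) (hd1 : d < 1)
    (Γ : ℝ) (hΓ : 0 < Γ) (ε₀ : ℝ) (hε₀ : 0 < ε₀) :
    ∃ K : ℝ, 0 < K ∧ ∃ c : ℝ, 0 < c ∧
      ∀ (n M R C : ℕ) (T : WeakGadget.Target n M) (J Δ ε : ℝ),
        (∀ j, T.a j ≠ T.b j) →
        T.Helse.PosSemidef →
        (∀ j, |T.γ j| ≤ Γ) →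
        0 < T.gammaMax →
        0 < ε → ε ≤ ε₀ →
        Δ = J * C →
        Δ = (M : ℝ) ^ 3 * (R : ℝ) ^ d →
        K * max (ε ^ (-(2 / d)))
          (max ((‖T.Helse‖ ^ 2 / (2 * (M : ℝ) ^ 4 * T.gammaMax)) ^ (1 / d))
            (((M : ℝ) ^ 3 * (ε ^ 2)⁻¹) ^ (1 / (1 - d)))) ≤ R →
        K * ((M : ℝ) ^ 3 * (R : ℝ) ^ d * ε⁻¹) ≤ C →
        (∀ j, |WeakGadget.beta T R C J j| ≤ c * ε) ∧
        |J| ≤ c * ε ∧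
        ∀ z : ℂ, ‖z‖ ≤ ε + ‖T.Helse‖ + ∑ j, |T.γ j| →
          WeakGadget.InvertibleOn (WeakGadget.projPlus n M R C)
            (z • 1 - WeakGadget.H n M R C J) ∧
          Summable (fun k : ℕ => ‖WeakGadget.term T R C J z (k + 2)‖) ∧
          ‖WeakGadget.selfEnergySeries (WeakGadget.projMinus n M R C)
              (WeakGadget.H n M R C J) (WeakGadget.V T R C J) z -
            WeakGadget.Heff T R C‖ ≤ c * ε ∧
          (∀ k : ℕ, 3 ≤ k →
            ‖WeakGadget.term T R C J z k‖ ≤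
              3 * √2 * Δ * √(18 * M * T.gammaMax / Δ) ^ k) ∧
          (IsUnit (z • 1 - (WeakGadget.H n M R C J + WeakGadget.V T R C J)) →
            WeakGadget.InvertibleOn (WeakGadget.projMinus n M R C)
              (z • 1 - (WeakGadget.H n M R C J + WeakGadget.V T R C J))⁻¹ ∧
            WeakGadget.selfEnergySeries (WeakGadget.projMinus n M R C)
                (WeakGadget.H n M R C J) (WeakGadget.V T R C J) z =
              WeakGadget.selfEnergy (WeakGadget.projMinus n M R C)
                (WeakGadget.H n M R C J) (WeakGadget.V T R C J) z) := by
  have hκ := WeakGadget.smallness_pos hΓ hε₀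
  have hκ1 : WeakGadget.smallness Γ ε₀ ≤ 1 :=
    (WeakGadget.smallness_le hΓ hε₀).trans (by norm_num)
  set κ := WeakGadget.smallness Γ ε₀ with hκdef
  have hK1 : 1 ≤ κ ^ (-(1 / d)) :=
    Real.one_le_rpow_of_pos_of_le_one_of_nonpos hκ hκ1 (by simpa using hd0.le)
  have hd1' : 0 < 1 - d := by linarith
  refine ⟨κ ^ (-(1 / d)), by positivity,
    -- The three summands serve `J`, `β` and the self-energy error, in this order.
    1 + √Γ + (4 * (Γ * ε₀ ^ 2 + Γ * √(18 * Γ) + Γ ^ 2 * ε₀) + 162 * Γ * √(18 * Γ)),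
    by positivity, ?_⟩
  intro n M R C T J Δ ε hab hpsd hγ hg hε hεε hΔ hΔ' hRK hCK
  have hle : ∀ j, |T.γ j| ≤ T.gammaMax :=
    fun j => le_ciSup (f := fun j => |T.γ j|) (Set.finite_range _).bddAbove j
  have hM : 0 < M := by
    rcases Nat.eq_zero_or_pos M with h | h
    · subst h
      -- The real supremum over the empty family is `0`, so a positive `gammaMax` forces `M > 0`.
      simp [WeakGadget.Target.gammaMax] at hg
    · exact h
  have hM1 : (1 : ℝ) ≤ M := by exact_mod_cast hM
  have hgΓ : T.gammaMax ≤ Γ := by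
    have : Nonempty (Fin M) := ⟨⟨0, hM⟩⟩
    exact ciSup_le hγ
  have hS : ∑ j, |T.γ j| ≤ M * T.gammaMax := by
    simpa using Finset.sum_le_card_nsmul Finset.univ _ _ fun j _ => hle j
  rw [mul_max_of_nonneg _ _ (by positivity), mul_max_of_nonneg _ _ (by positivity), max_le_iff,
    max_le_iff] at hRK
  obtain ⟨hR1, hR2, hR3⟩ := hRK
  have hR : 0 < (R : ℝ) := lt_of_lt_of_le (by positivity) hR1
  have hRd : 0 < (R : ℝ) ^ d := Real.rpow_pos_of_pos hR d
  have hΔ0 : 0 < Δ := by rw [hΔ']; positivity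
  have hC : 0 < (C : ℝ) := lt_of_lt_of_le (by positivity) hCK
  have hJ : 0 < J := by
    rw [hΔ] at hΔ0
    exact pos_of_mul_pos_left hΔ0 hC.le
  have hgap : (M : ℝ) ^ 3 ≤ κ * ε ^ 2 * Δ := by
    have e : ε ^ (-(2 / d)) = ((ε ^ 2)⁻¹) ^ (1 / d) := by
      rw [← Real.rpow_natCast, ← Real.rpow_neg hε.le, ← Real.rpow_mul hε.le]
      congr 1
      push_cast
      ring
    rw [e] at hR1
    have h1 := WeakGadget.le_mul_rpow_of_rpow_le hd0 hκ (by positivity) hR1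
    rw [inv_le_iff_one_le_mul₀ (by positivity)] at h1
    calc (M : ℝ) ^ 3 = M ^ 3 * 1 := by ring
      _ ≤ M ^ 3 * (κ * R ^ d * ε ^ 2) := by gcongr
      _ = _ := by rw [hΔ']; ring
  have hrest : ‖T.Helse‖ ^ 2 ≤ κ * (2 * M * T.gammaMax * Δ) := by
    have h1 := WeakGadget.le_mul_rpow_of_rpow_le hd0 hκ (by positivity) hR2
    rw [div_le_iff₀ (by positivity)] at h1
    refine h1.trans_eq ?_
    rw [hΔ']; ring
  -- The third condition on `R` reads `M³ ≤ ε² R ^ (1 - d)`; multiplying by `R ^ d` bounds the gap,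
  -- and with it `β² = |γ| Δ / (2 R)`.
  have hweak : Δ ≤ ε ^ 2 * R := by
    have h1 : ((M : ℝ) ^ 3 * (ε ^ 2)⁻¹) ^ (1 / (1 - d)) ≤ R :=
      (le_mul_of_one_le_left (by positivity) hK1).trans hR3
    have h2 := Real.rpow_le_rpow (by positivity) h1 hd1'.le
    rw [← Real.rpow_mul (by positivity), one_div_mul_cancel hd1'.ne', Real.rpow_one,
      ← div_eq_mul_inv, div_le_iff₀ (by positivity)] at h2
    have h3 : (R : ℝ) ^ (1 - d) * R ^ d = R := by
      rw [← Real.rpow_add hR, sub_add_cancel, Real.rpow_one]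
    calc Δ = M ^ 3 * R ^ d := hΔ'
      _ ≤ R ^ (1 - d) * ε ^ 2 * R ^ d := by gcongr
      _ = ε ^ 2 * (R ^ (1 - d) * R ^ d) := by ring
      _ = _ := by rw [h3]
  have hcoef : 0 ≤ 4 * (Γ * ε₀ ^ 2 + Γ * √(18 * Γ) + Γ ^ 2 * ε₀) + 162 * Γ * √(18 * Γ) := by
    positivity
  refine ⟨fun j => ?_, ?_, fun z hz => ?_⟩
  · have h1 : WeakGadget.beta T R C J j ≤ √Γ * ε := by
      refine Real.sqrt_le_iff.2 ⟨by positivity, ?_⟩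
      rw [mul_pow, Real.sq_sqrt hΓ.le, ← hΔ, div_le_iff₀ (by positivity)]
      calc |T.γ j| * Δ ≤ Γ * (ε ^ 2 * R) := by gcongr; exact hγ j
        _ ≤ 2 * (Γ * (ε ^ 2 * R)) := le_mul_of_one_le_left (by positivity) one_le_two
        _ = _ := by ring
    rw [abs_of_nonneg (WeakGadget.beta_nonneg T j)]
    refine h1.trans (mul_le_mul_of_nonneg_right ?_ hε.le)
    linarith
  -- The condition on `C` gives `Δ / ε ≤ C`, and `Δ = J C`.
  · have h1 : J ≤ ε := by
      rw [← hΔ', ← div_eq_mul_inv, hΔ] at hCK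
      have h2 := (le_mul_of_one_le_left (by positivity) hK1).trans hCK
      rw [div_le_iff₀ hε] at h2
      nlinarith
    rw [abs_of_pos hJ]
    refine h1.trans (le_mul_of_one_le_left hε.le ?_)
    have := Real.sqrt_nonneg Γ
    linarith
  · have r : WeakGadget.Regime Γ ε₀ ε M T.gammaMax (∑ j, |T.γ j|) ‖T.Helse‖ (J * C) := by
      rw [← hΔ]
      exact ⟨hΓ, hε₀, hε, hεε, hM1, hg, hgΓ, Finset.sum_nonneg fun j _ => abs_nonneg _, hS,
        norm_nonneg _, hgap, hrest⟩
    obtain ⟨h1, h2, h3, h4, h5⟩ :=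
      WeakGadget.gadget_of_regime T hab hJ.le (by exact_mod_cast hR) r hz
    rw [hΔ]
    refine ⟨h1, h2, h3.trans (mul_le_mul_of_nonneg_right ?_ hε.le), h4, h5⟩
    have := Real.sqrt_nonneg Γ
    linarith
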